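/- **Setting.** A generalized switch has $n$ queues operating in discrete time, $k=0,1,2,\dots$ The channel states $M(k)$ are i.i.d. in a finite set $\mathcal M$ with $\Pr(M(1)=m)=\psi_m$. In channel state $m$ the feasible service rate vectors form a finite non-empty set $\mathcal S^{(m)}\subset\mathbb R^n_+$ which contains the projections of its elements on the coordinate axes. The arrival vectors $a(k)\in\mathbb R_+^n$ are i.i.d., satisfy $a_i(1)\le A_{\max}$ almost surely for a fixed constant $A_{\max}$, and are independent of the channel states; $(a(k),M(k))$ is independent of the past, and $a(k)$ is independent of the past, of $M(k)$ and of the schedule chosen in slot $k$. The queue lengths $q(k)\in\mathbb R^n_+$ satisfy $$q(k+1)=q(k)+a(k)-s(k)+u(k),\qquad q_i(k+1)\,u_i(k)=0 \ \text{ for all } i,$$ where $u(k)\ge 0$ is the unused service and the offered service $s(k)$ is chosen by MaxWeight, $s(k)\in\arg\max_{x\in\mathcal S^{(M(k))}}\langle q(k),x\rangle$, with ties broken in an arbitrary, possibly random, way. The capacity region is $\mathcal C=\sum_{m}\psi_m\,\mathrm{ConvexHull}(\mathcal S^{(m)})$, and it is written as $\mathcal C=\{x\in\mathbb R^n_+:\langle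 c^{(\ell)},x\rangle\le b^{(\ell)},\ \ell=1,\dots,L\}$ with $c^{(\ell)}\ge 0$, $\|c^{(\ell)}\|=1$ and $b^{(\ell)}>0$. Put $\mathcal F^{(\ell)}=\{x\in\mathcal C:\langle c^{(\ell)},x\rangle=b^{(\ell)}\}$. Fix $\nu$ on the boundary of $\mathcal C$, let $P=\{\ell:\nu\in\mathcal F^{(\ell)}\}$, and assume that $\nu_i>0$ for every $i$ such that $c^{(\ell)}_i>0$ for some $\ell\in P$. No complete resource pooling condition is assumed. Let $\tilde P\subseteq P$ be maximal such that the vectors $c^{(\ell)}$, $\ell\in\tilde P$, are linearly independent, let $C$ be the matrix with columns $c^{(\ell)}$, $\ell\in\tilde P$, and let $H=C(C^TC)^{-1}C^T$. Let $\Sigma_B$ be the covariance matrix of the random vector $(B_\ell)_{\ell\in\tilde P}$ that equals $(\max_{x\in\mathcal S^{(m)}}\langle c^{(\ell)},x\rangle)_{\ell\in\tilde P}$ with probability $\psi_m$, $m\in\mathcal M$. For $\epsilon\in(0,1)$ consider the switch whose arrival rate is $\mathbb E[a^{(\epsilon)}(1)]=(1-\epsilon)\nu$; let $\Sigma_a^{(\epsilon)}$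 be the covariance matrix of $a^{(\epsilon)}(1)$, and let $\overline q^{(\epsilon)}$ be the steady-state queue length vector, that is, the limit in distribution of $q^{(\epsilon)}(k)$ as $k\to\infty$. **Theorem.** There are $\epsilon_0\in(0,1)$ and a constant $\beta$ independent of $\epsilon$ such that for every $\epsilon\in(0,\epsilon_0)$ and every $w\in\mathcal C$ that belongs to $\mathcal F^{(\ell)}$ for all $\ell\in P$, the expectation $\mathbb E[\langle\overline q^{(\epsilon)},w\rangle]$ is finite and $$\left|\,\mathbb E\big[\langle\overline q^{(\epsilon)},w\rangle\big]-\frac1{2\epsilon}\mathbf 1^T\big(H\circ\Sigma_a^{(\epsilon)}\big)\mathbf 1-\frac1{2\epsilon}\mathbf 1^T\big((C^TC)^{-1}\circ\Sigma_B\big)\mathbf 1\,\right|\le\beta\log\frac1\epsilon ,$$ where $\circ$ is the entrywise product of matrices. -/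

import Mathlib

open MeasureTheory ProbabilityTheory Filter Topology
open scoped Matrix Pointwise

/-- Vectors of `ℝⁿ` with the Euclidean norm and inner product. -/
abbrev Vec (n : ℕ) : Type := EuclideanSpace ℝ (Fin n)

/-- The static data of a generalized switch with `n` queues and finite channel state space `𝓜`:
the pmf `ψ` of the channel state, and for every channel state `m` the finite non-empty set `S m` of
feasible (non-negative) service rate vectors, which contains the projections of its elements on the
coordinate axes. -/
structure GeneralizedSwitch (n : ℕ) (𝓜 : Type*) where
  ψ : PMF 𝓜
  S : 𝓜 → Finset (Vec n)
  S_nonempty : ∀ m, (S m).Nonempty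
  S_nonneg : ∀ m, ∀ x ∈ S m, ∀ i, 0 ≤ x i
  S_axis : ∀ m, ∀ x ∈ S m, ∀ i, EuclideanSpace.single i (x i) ∈ S m

namespace GeneralizedSwitch

variable {n L : ℕ} {𝓜 : Type*}

/-- The capacity region: the Minkowski sum `∑ₘ ψₘ ConvexHull(S m)`. -/
noncomputable def capacityRegion [Fintype 𝓜] (G : GeneralizedSwitch n 𝓜) : Set (Vec n) :=
  ∑ m, (G.ψ m).toReal • convexHull ℝ (G.S m : Set (Vec n))

/-- `c, b` represent the capacity region as `{x ≥ 0 : ⟨c ℓ, x⟩ ≤ b ℓ for all ℓ}`, with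
`c ℓ ≥ 0`, `‖c ℓ‖ = 1` and `b ℓ > 0`. -/
structure IsHalfspaceRep [Fintype 𝓜] (G : GeneralizedSwitch n 𝓜)
    (c : Fin L → Vec n) (b : Fin L → ℝ) : Prop where
  eq : G.capacityRegion = {x | (∀ i, 0 ≤ x i) ∧ ∀ ℓ, inner ℝ (c ℓ) x ≤ b ℓ}
  c_nonneg : ∀ ℓ i, 0 ≤ c ℓ i
  c_norm : ∀ ℓ, ‖c ℓ‖ = 1
  b_pos : ∀ ℓ, 0 < b ℓ

/-- The facet `{x ∈ 𝒞 : ⟨c ℓ, x⟩ = b ℓ}` of the capacity region. -/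
def facet [Fintype 𝓜] (G : GeneralizedSwitch n 𝓜) (c : Fin L → Vec n) (b : Fin L → ℝ)
    (ℓ : Fin L) : Set (Vec n) :=
  {x | x ∈ G.capacityRegion ∧ inner ℝ (c ℓ) x = b ℓ}

/-- The set `P` of the indices of the facets through `ν`. -/
def facetsThrough [Fintype 𝓜] (G : GeneralizedSwitch n 𝓜) (c : Fin L → Vec n) (b : Fin L → ℝ)
    (ν : Vec n) : Set (Fin L) :=
  {ℓ | ν ∈ G.facet c b ℓ}

/-- The maximum `v`-weighted service rate `max_{x ∈ S m} ⟨v, x⟩` in channel state `m`. -/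
noncomputable def maxWeight (G : GeneralizedSwitch n 𝓜) (v : Vec n) (m : 𝓜) : ℝ :=
  (G.S m).sup' (G.S_nonempty m) fun x => inner ℝ v x

/-- The schedules that MaxWeight may choose at queue length vector `q` in channel state `m`. -/
def maxWeightSchedules (G : GeneralizedSwitch n 𝓜) (q : Vec n) (m : 𝓜) : Set (Vec n) :=
  {x | x ∈ G.S m ∧ ∀ y ∈ G.S m, inner ℝ q y ≤ inner ℝ q x}

/-- The covariance matrix `Σ_B` of the vector `B`, whose coordinate `B_ℓ` takes the value
`max_{x ∈ S m} ⟨c ℓ, x⟩` when the channel state is `m`; only the coordinates in `J` are kept. -/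
noncomputable def covB [MeasurableSpace 𝓜] (G : GeneralizedSwitch n 𝓜) (c : Fin L → Vec n)
    (J : Finset (Fin L)) : Matrix J J ℝ :=
  Matrix.of fun ℓ ℓ' => cov[G.maxWeight (c ℓ), G.maxWeight (c ℓ'); G.ψ.toMeasure]

/-- The generalized switch in discrete time under MaxWeight, on a probability space `(Ω, μ)`:
channel states `M k`, arrivals `a k`, offered services `s k`, unused services `u k` and queue
lengths `q k`. -/
structure IsMaxWeightDynamics [MeasurableSpace 𝓜] (G : GeneralizedSwitch n 𝓜)
    {Ω : Type*} [MeasurableSpace Ω] (μ : Measure Ω)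
    (M : ℕ → Ω → 𝓜) (a s u q : ℕ → Ω → Vec n) : Prop where
  measurable_M : ∀ k, Measurable (M k)
  measurable_a : ∀ k, Measurable (a k)
  measurable_s : ∀ k, Measurable (s k)
  measurable_u : ∀ k, Measurable (u k)
  measurable_q : ∀ k, Measurable (q k)
  /-- The channel state has pmf `ψ` in every slot. -/
  law_M : ∀ k m, μ (M k ⁻¹' {m}) = G.ψ m
  /-- The arrival vectors are identically distributed and non-negative. -/
  ident_a : ∀ k, IdentDistrib (a k) (a 1) μ μ
  a_nonneg : ∀ k, ∀ᵐ ω ∂μ, ∀ i, 0 ≤ a k ω i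
  /-- The channel state of slot `k` is independent of everything that happened before slot `k`. -/
  indep_M : ∀ k, IndepFun
    (fun ω => ((fun j : Fin (k + 1) => q j ω), fun j : Fin k => (M j ω, a j ω, s j ω))) (M k) μ
  /-- The arrivals of slot `k` are independent of everything that happened before slot `k`, of the
  channel state of slot `k` and of the schedule chosen in slot `k`. (With `indep_M`, this makes the
  sequences `a` and `M` i.i.d. and independent of each other.) -/
  indep_a : ∀ k, IndepFun
    (fun ω => (((fun j : Fin (k + 1) => q j ω), fun j : Fin k => (M j ω, a j ω, s j ω)),
      M k ω, s k ω)) (a k) μ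
  /-- MaxWeight scheduling; ties are broken in any, possibly random, way. -/
  maxWeight : ∀ k, ∀ᵐ ω ∂μ, s k ω ∈ G.maxWeightSchedules (q k ω) (M k ω)
  q_nonneg : ∀ k, ∀ᵐ ω ∂μ, ∀ i, 0 ≤ q k ω i
  u_nonneg : ∀ k, ∀ᵐ ω ∂μ, ∀ i, 0 ≤ u k ω i
  /-- The queue recursion. -/
  evolution : ∀ k, ∀ᵐ ω ∂μ, q (k + 1) ω = q k ω + a k ω - s k ω + u k ω
  /-- There is unused service only where the queue is empty at the start of the next slot. -/
  unused : ∀ k, ∀ᵐ ω ∂μ, ∀ i, q (k + 1) ω i * u k ω i = 0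

end GeneralizedSwitch

/-- The matrix `C` whose columns are the vectors `c ℓ`, `ℓ ∈ J`. -/
def colMatrix {n L : ℕ} (c : Fin L → Vec n) (J : Finset (Fin L)) : Matrix (Fin n) J ℝ :=
  Matrix.of fun i ℓ => c ℓ i

/-- The matrix `H = C (Cᵀ C)⁻¹ Cᵀ`. -/
noncomputable def projMatrix {n L : ℕ} (c : Fin L → Vec n) (J : Finset (Fin L)) :
    Matrix (Fin n) (Fin n) ℝ :=
  colMatrix c J * ((colMatrix c J)ᵀ * colMatrix c J)⁻¹ * (colMatrix c J)ᵀ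

/-- The covariance matrix of a random vector. -/
noncomputable def covMatrix {n : ℕ} {Ω : Type*} [MeasurableSpace Ω] (μ : Measure Ω)
    (X : Ω → Vec n) : Matrix (Fin n) (Fin n) ℝ :=
  Matrix.of fun i j => cov[fun ω => X ω i, fun ω => X ω j; μ]

/-- `1ᵀ A 1`, the sum of the entries of `A`. -/
def onesForm {ι : Type*} [Fintype ι] (A : Matrix ι ι ℝ) : ℝ :=
  (1 : ι → ℝ) ⬝ᵥ (A *ᵥ (1 : ι → ℝ))

/-!
The proof is the drift method for the quadratic form `⟨q, H q⟩` (`projForm`), where `H` is the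
orthogonal projection onto the span of the normals `c ℓ` of the facets through `ν`.

*State space collapse.* The normals of the facets through `ν` generate a closed convex cone. On it
the support function of the capacity region is `p ↦ ⟨p, ν⟩`, and the positivity assumption on `ν`
leaves room in the capacity region to move from `ν` in every direction `q - p`, where `p` is the
projection of `q ≥ 0` to the cone. Hence MaxWeight pushes the queue lengths towards the cone at a
rate that does not depend on `ε` (`exists_drift_normalCone`), and, as the increments are bounded,
the distance to the cone has a late-time exponential moment bounded uniformly in `ε`
(`integral_exp_le`, `eventually_integral_exp_le`). The same estimate with the cone `{0}`, where
the rate is of order `ε` (`exists_drift_zero`), bounds an exponential moment of the queue lengths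
themselves, for each `ε`.

*Balance of the quadratic form.* For `q' = q + a - s + u` the change of `⟨q, H q⟩` is, up to terms
of mean zero, `-2 ε ⟨q, H ν⟩` plus the squared noise of the arrivals and of the channel, whose
means are the two covariance terms, plus errors (`exists_abs_drift_sub_le`). The errors are
controlled by products of the distance to the cone with the unused service, or with the loss of
the schedule `s` in the directions `c ℓ`. The latter two are bounded, and since `⟨c ℓ, q⟩` is
nearly stationary, their means are `O(ε)` (`integral_gap_add_integral_unused`). Truncating the
exponential tail of the distance at a level of order `log (1/ε)` shows that the products have mean
`O(ε log (1/ε))` (`integral_mul_le_log`). On the cone `⟨q, H ν⟩ = ⟨q, ν⟩ = ⟨q, w⟩`, so dividing by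
`2 ε` gives the estimate in one nearly stationary slot (`exists_heavyTraffic_bound`).

*Steady state.* The initial queue lengths need not have any moments, and the limit in distribution
need not come with convergence of moments. Therefore the initial queue lengths are conditioned to
be bounded, which changes neither the laws of the arrivals and channel states nor their
independence of the past (`exists_switchStep_cond`). Along late slots the bound on the conditioned
event tends to infinity, and the exponential moments give convergence of the means of linear and
quadratic functions to those of the steady state (`tendsto_integral_cond`). So these slots are
nearly stationary, and the estimate passes to the limit.
-/

/-! ### The capacity region and its support function -/

lemma exists_pos_forall_le {ι : Type*} [Finite ι] (f : ι → ℝ) (hf : ∀ i, 0 < f i) :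
    ∃ δ : ℝ, 0 < δ ∧ ∀ i, δ ≤ f i := by
  cases isEmpty_or_nonempty ι
  · exact ⟨1, one_pos, fun i => isEmptyElim i⟩
  · obtain ⟨i, hi⟩ := Finite.exists_min f
    exact ⟨f i, hf i, hi⟩

lemma norm_le_sum_abs {n : ℕ} (x : Vec n) : ‖x‖ ≤ ∑ i, |x i| := by
  rw [EuclideanSpace.norm_eq]
  refine (Real.sqrt_le_sqrt (Finset.sum_sq_le_sq_sum_of_nonneg (s := Finset.univ)
    (f := fun i => ‖x i‖) fun i _ => norm_nonneg _)).trans ?_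
  rw [Real.sqrt_sq (Finset.sum_nonneg fun i _ => norm_nonneg _)]
  simp [Real.norm_eq_abs]

namespace GeneralizedSwitch

variable {n L : ℕ} {𝓜 : Type*}

lemma inner_le_maxWeight (G : GeneralizedSwitch n 𝓜) (v : Vec n) {m : 𝓜} {x : Vec n}
    (hx : x ∈ G.S m) : inner ℝ v x ≤ G.maxWeight v m :=
  Finset.le_sup' (fun x => inner ℝ v x) hx

lemma exists_maxWeight_eq (G : GeneralizedSwitch n 𝓜) (v : Vec n) (m : 𝓜) :
    ∃ x ∈ G.S m, G.maxWeight v m = inner ℝ v x :=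
  Finset.exists_mem_eq_sup' (G.S_nonempty m) fun x => inner ℝ v x

lemma inner_eq_maxWeight (G : GeneralizedSwitch n 𝓜) {q x : Vec n} {m : 𝓜}
    (hx : x ∈ G.maxWeightSchedules q m) : inner ℝ q x = G.maxWeight q m := by
  obtain ⟨y, hy, h⟩ := G.exists_maxWeight_eq q m
  exact le_antisymm (G.inner_le_maxWeight q hx.1) (h ▸ hx.2 y hy)

lemma continuous_maxWeight (G : GeneralizedSwitch n 𝓜) (m : 𝓜) :
    Continuous fun v => G.maxWeight v m := by
  unfold maxWeight
  exact Continuous.finset_sup'_apply _ fun x _ => by fun_prop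

lemma exists_norm_service_le [Finite 𝓜] (G : GeneralizedSwitch n 𝓜) :
    ∃ B : ℝ, 0 < B ∧ ∀ m, ∀ x ∈ G.S m, ‖x‖ ≤ B := by
  cases nonempty_fintype 𝓜
  have h : (⋃ m, (G.S m : Set (Vec n))).Finite := Set.finite_iUnion fun m => (G.S m).finite_toSet
  obtain ⟨B, hB⟩ := h.isBounded.exists_norm_le
  refine ⟨max B 1, by positivity, fun m x hx => (hB x ?_).trans (le_max_left _ _)⟩
  exact Set.mem_iUnion.2 ⟨m, hx⟩

variable [Fintype 𝓜]

/-- The average over the channel states of the maximum `v`-weighted service rate. By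
`inner_le_meanMaxWeight` and `exists_inner_eq_meanMaxWeight` it is the support function of the
capacity region. -/
noncomputable def meanMaxWeight (G : GeneralizedSwitch n 𝓜) (v : Vec n) : ℝ :=
  ∑ m, (G.ψ m).toReal * G.maxWeight v m

lemma continuous_meanMaxWeight (G : GeneralizedSwitch n 𝓜) : Continuous G.meanMaxWeight :=
  continuous_finsetSum _ fun m _ => continuous_const.mul (G.continuous_maxWeight m)

lemma inner_le_meanMaxWeight (G : GeneralizedSwitch n 𝓜) (v : Vec n) {x : Vec n}
    (hx : x ∈ G.capacityRegion) : inner ℝ v x ≤ G.meanMaxWeight v := by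
  obtain ⟨g, hg, rfl⟩ := (Set.mem_fintype_sum _ _).1 hx
  rw [inner_sum]
  refine Finset.sum_le_sum fun m _ => ?_
  obtain ⟨y, hy, hyg⟩ := hg m
  rw [← hyg]
  simp only [inner_smul_right]
  refine mul_le_mul_of_nonneg_left ?_ ENNReal.toReal_nonneg
  have hconv : convexHull ℝ (G.S m : Set (Vec n)) ⊆ {y | inner ℝ v y ≤ G.maxWeight v m} :=
    convexHull_min (fun x hx => G.inner_le_maxWeight v hx)
      (convex_halfSpace_le (innerSL ℝ v).isLinear _)
  exact hconv hy

lemma exists_inner_eq_meanMaxWeight (G : GeneralizedSwitch n 𝓜) (v : Vec n) :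
    ∃ x ∈ G.capacityRegion, inner ℝ v x = G.meanMaxWeight v := by
  choose y hy h using G.exists_maxWeight_eq v
  refine ⟨∑ m, (G.ψ m).toReal • y m, ?_, ?_⟩
  · exact (Set.mem_fintype_sum _ _).2
      ⟨_, fun m => ⟨y m, subset_convexHull ℝ _ (hy m), rfl⟩, rfl⟩
  · simp [inner_sum, inner_smul_right, meanMaxWeight, h]

lemma exists_norm_capacityRegion_le {G : GeneralizedSwitch n 𝓜} {c : Fin L → Vec n}
    {b : Fin L → ℝ} (hcb : G.IsHalfspaceRep c b) :
    ∃ B : ℝ, 0 < B ∧ ∀ x ∈ G.capacityRegion, ‖x‖ ≤ B := by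
  refine ⟨∑ i, |G.meanMaxWeight (EuclideanSpace.single i 1)| + 1, by positivity, fun x hx => ?_⟩
  have h0 : ∀ i, 0 ≤ x i := by rw [hcb.eq] at hx; exact hx.1
  have h1 : ∀ i, x i ≤ |G.meanMaxWeight (EuclideanSpace.single i 1)| := fun i => by
    have := G.inner_le_meanMaxWeight (EuclideanSpace.single i 1) hx
    rw [EuclideanSpace.inner_single_left] at this
    simp only [map_one, one_mul] at this
    exact this.trans (le_abs_self _)
  have h2 := norm_le_sum_abs x
  have h3 : ∑ i, |x i| ≤ ∑ i, |G.meanMaxWeight (EuclideanSpace.single i 1)| :=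
    Finset.sum_le_sum fun i _ => by rw [abs_of_nonneg (h0 i)]; exact h1 i
  linarith

lemma IsHalfspaceRep.isClosed {G : GeneralizedSwitch n 𝓜} {c : Fin L → Vec n}
    {b : Fin L → ℝ} (hcb : G.IsHalfspaceRep c b) : IsClosed G.capacityRegion := by
  rw [hcb.eq, Set.ofPred_and]
  refine IsClosed.inter ?_ ?_
  · simp only [Set.ofPred_forall]
    exact isClosed_iInter fun i => isClosed_le continuous_const (by fun_prop)
  · simp only [Set.ofPred_forall]
    exact isClosed_iInter fun i => isClosed_le (by fun_prop) continuous_const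

end GeneralizedSwitch

/-! ### The normal cone and the projection onto it -/

section NormalCone

variable {n L : ℕ}

/-- The cone generated by the vectors `c ℓ`, `ℓ ∈ P`, encoded as the bipolar of these vectors. When
`P` indexes the facets through `ν`, this is the cone to which the queue lengths collapse. -/
def normalCone (c : Fin L → Vec n) (P : Set (Fin L)) : Set (Vec n) :=
  {p | ∀ y, (∀ ℓ ∈ P, inner ℝ (c ℓ) y ≤ 0) → inner ℝ p y ≤ 0}

variable {c : Fin L → Vec n} {P : Set (Fin L)}

lemma zero_mem_normalCone : (0 : Vec n) ∈ normalCone c P := fun y _ => by simp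

lemma mem_normalCone_of_mem {ℓ : Fin L} (h : ℓ ∈ P) : c ℓ ∈ normalCone c P := fun _ hy => hy ℓ h

lemma smul_mem_normalCone {p : Vec n} (hp : p ∈ normalCone c P) {r : ℝ} (hr : 0 ≤ r) :
    r • p ∈ normalCone c P := fun y hy => by
  rw [real_inner_smul_left]
  exact mul_nonpos_of_nonneg_of_nonpos hr (hp y hy)

lemma isClosed_normalCone : IsClosed (normalCone c P) := by
  simp only [normalCone, Set.ofPred_forall]
  exact isClosed_iInter fun y => isClosed_iInter fun _ => isClosed_le (by fun_prop) continuous_const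

lemma convex_normalCone : Convex ℝ (normalCone c P) := by
  intro x hx y hy r s hr hs _ z hz
  rw [inner_add_left, real_inner_smul_left, real_inner_smul_left]
  have h1 := mul_nonpos_of_nonneg_of_nonpos hr (hx z hz)
  have h2 := mul_nonpos_of_nonneg_of_nonpos hs (hy z hz)
  linarith

lemma inner_eq_zero_of_mem_normalCone {p y : Vec n} (hp : p ∈ normalCone c P)
    (hy : ∀ ℓ ∈ P, inner ℝ (c ℓ) y = 0) : inner ℝ p y = 0 := by
  refine le_antisymm (hp y fun ℓ hℓ => (hy ℓ hℓ).le) ?_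
  have := hp (-y) fun ℓ hℓ => by rw [inner_neg_right, hy ℓ hℓ, neg_zero]
  rw [inner_neg_right] at this
  linarith

lemma nonneg_of_mem_normalCone (hc : ∀ ℓ i, 0 ≤ c ℓ i) {p : Vec n} (hp : p ∈ normalCone c P)
    (i : Fin n) : 0 ≤ p i := by
  have := hp (-EuclideanSpace.single i 1) fun ℓ _ => by
    rw [inner_neg_right, EuclideanSpace.inner_single_right]
    simpa using hc ℓ i
  rw [inner_neg_right, EuclideanSpace.inner_single_right] at this
  simpa using this

lemma apply_eq_zero_of_mem_normalCone {p : Vec n} (hp : p ∈ normalCone c P) {i : Fin n}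
    (hi : ∀ ℓ ∈ P, c ℓ i = 0) : p i = 0 := by
  have := inner_eq_zero_of_mem_normalCone (y := EuclideanSpace.single i 1) hp fun ℓ hℓ => by
    rw [EuclideanSpace.inner_single_right]
    simpa using hi ℓ hℓ
  rw [EuclideanSpace.inner_single_right] at this
  simpa using this

lemma exists_coneProj (c : Fin L → Vec n) (P : Set (Fin L)) (x : Vec n) :
    ∃ p ∈ normalCone c P, inner ℝ (x - p) p = 0 ∧ ∀ y ∈ normalCone c P, inner ℝ (x - p) y ≤ 0 := by
  obtain ⟨p, hp, h⟩ := exists_norm_eq_iInf_of_complete_convex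
    ⟨0, zero_mem_normalCone (c := c) (P := P)⟩
    isClosed_normalCone.isComplete convex_normalCone x
  rw [norm_eq_iInf_iff_real_inner_le_zero convex_normalCone hp] at h
  have h1 := h 0 zero_mem_normalCone
  have h2 := h ((2 : ℝ) • p) (smul_mem_normalCone hp (by norm_num))
  have h3 : inner ℝ (x - p) p = 0 := by
    simp only [inner_sub_right, inner_zero_right, inner_smul_right] at h1 h2
    linarith
  refine ⟨p, hp, h3, fun y hy => ?_⟩
  have := h y hy
  rw [inner_sub_right, h3] at this
  linarith

/-- The metric projection onto the cone `normalCone c P`. -/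
noncomputable def coneProj (c : Fin L → Vec n) (P : Set (Fin L)) (x : Vec n) : Vec n :=
  (exists_coneProj c P x).choose

lemma coneProj_mem (x : Vec n) : coneProj c P x ∈ normalCone c P :=
  (exists_coneProj c P x).choose_spec.1

lemma inner_sub_coneProj_self (x : Vec n) : inner ℝ (x - coneProj c P x) (coneProj c P x) = 0 :=
  (exists_coneProj c P x).choose_spec.2.1

lemma inner_sub_coneProj_le (x : Vec n) {y : Vec n} (hy : y ∈ normalCone c P) :
    inner ℝ (x - coneProj c P x) y ≤ 0 :=
  (exists_coneProj c P x).choose_spec.2.2 y hy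

lemma norm_sub_coneProj_le (x : Vec n) {y : Vec n} (hy : y ∈ normalCone c P) :
    ‖x - coneProj c P x‖ ≤ ‖x - y‖ := by
  have h1 := inner_sub_coneProj_self (c := c) (P := P) x
  have h2 := inner_sub_coneProj_le x hy
  set p := coneProj c P x
  have h3 : ‖x - y‖ ^ 2 = ‖x - p‖ ^ 2 + 2 * inner ℝ (x - p) (p - y) + ‖p - y‖ ^ 2 := by
    rw [← norm_add_sq_real]; congr 2; abel
  rw [inner_sub_right] at h3
  exact le_of_sq_le_sq (by nlinarith [sq_nonneg ‖p - y‖]) (norm_nonneg _)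

lemma continuous_coneProj : Continuous (coneProj c P) := by
  refine (LipschitzWith.of_dist_le_mul (K := 1) fun x y => ?_).continuous
  rw [dist_eq_norm, dist_eq_norm, NNReal.coe_one, one_mul]
  have h1 := inner_sub_coneProj_self (c := c) (P := P) x
  have h2 := inner_sub_coneProj_self (c := c) (P := P) y
  have h3 := inner_sub_coneProj_le x (coneProj_mem (c := c) (P := P) y)
  have h4 := inner_sub_coneProj_le y (coneProj_mem (c := c) (P := P) x)
  set p := coneProj c P x
  set r := coneProj c P y
  have h5 : ‖p - r‖ ^ 2 ≤ inner ℝ (x - y) (p - r) := by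
    rw [← real_inner_self_eq_norm_sq]
    simp only [inner_sub_left, inner_sub_right] at *
    linarith
  have h6 := real_inner_le_norm (x - y) (p - r)
  by_contra! hlt
  nlinarith [norm_nonneg (x - y), norm_nonneg (p - r)]

lemma inner_coneProj_self (x : Vec n) :
    inner ℝ x (x - coneProj c P x) = ‖x - coneProj c P x‖ ^ 2 := by
  have h := inner_sub_coneProj_self (c := c) (P := P) x
  rw [← real_inner_self_eq_norm_sq]
  conv_rhs => rw [inner_sub_right, h, sub_zero, real_inner_comm]

end NormalCone

namespace GeneralizedSwitch

variable {n L : ℕ} {𝓜 : Type*} [Fintype 𝓜]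

section

variable {G : GeneralizedSwitch n 𝓜} {c : Fin L → Vec n} {b : Fin L → ℝ}

lemma IsHalfspaceRep.mem_iff (hcb : G.IsHalfspaceRep c b) {x : Vec n} :
    x ∈ G.capacityRegion ↔ (∀ i, 0 ≤ x i) ∧ ∀ ℓ, inner ℝ (c ℓ) x ≤ b ℓ := by
  rw [hcb.eq]; rfl

/-- On the normal cone at `ν` the support function of the capacity region is attained at `ν`. -/
lemma IsHalfspaceRep.meanMaxWeight_eq (hcb : G.IsHalfspaceRep c b) {ν : Vec n}
    (hν : ν ∈ G.capacityRegion) {p : Vec n} (hp : p ∈ normalCone c (G.facetsThrough c b ν)) :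
    G.meanMaxWeight p = inner ℝ p ν := by
  refine le_antisymm ?_ (G.inner_le_meanMaxWeight p hν)
  obtain ⟨x, hx, h⟩ := G.exists_inner_eq_meanMaxWeight p
  have := hp (x - ν) fun ℓ hℓ => by
    rw [inner_sub_right, hℓ.2]
    linarith [(hcb.mem_iff.1 hx).2 ℓ]
  rw [inner_sub_right] at this
  linarith

/-- Below capacity MaxWeight pushes the queue lengths towards `0`, at a rate proportional to the
distance `ε` of the load from capacity. -/
lemma IsHalfspaceRep.exists_drift_zero (hcb : G.IsHalfspaceRep c b) {ν : Vec n}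
    (hν : ν ∈ G.capacityRegion) :
    ∃ δ : ℝ, 0 < δ ∧ ∀ ε : ℝ, 0 < ε → ε < 1 → ∀ q : Vec n, (∀ i, 0 ≤ q i) →
      inner ℝ q ((1 - ε) • ν) - G.meanMaxWeight q ≤ -(ε * δ) * ‖q‖ := by
  obtain ⟨δ, hδ, hδb⟩ := exists_pos_forall_le b hcb.b_pos
  refine ⟨δ, hδ, fun ε h0 h1 q hq => ?_⟩
  rcases eq_or_ne q 0 with rfl | hq0
  · have := G.inner_le_meanMaxWeight 0 hν
    simpa using this
  have hqn : 0 < ‖q‖ := norm_pos_iff.2 hq0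
  have hνC := hcb.mem_iff.1 hν
  have hx : (1 - ε) • ν + (ε * δ / ‖q‖) • q ∈ G.capacityRegion := by
    refine hcb.mem_iff.2 ⟨fun i => ?_, fun ℓ => ?_⟩
    · have := hνC.1 i
      have := hq i
      have : 0 ≤ 1 - ε := by linarith
      simp only [PiLp.add_apply, PiLp.smul_apply, smul_eq_mul]
      positivity
    · rw [inner_add_right, real_inner_smul_right, real_inner_smul_right]
      have e1 : inner ℝ (c ℓ) q ≤ ‖q‖ := by
        simpa [hcb.c_norm ℓ] using real_inner_le_norm (c ℓ) q
      have e2 : ε * δ / ‖q‖ * inner ℝ (c ℓ) q ≤ ε * δ := by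
        calc _ ≤ ε * δ / ‖q‖ * ‖q‖ := by gcongr
          _ = ε * δ := by field_simp
      have e3 : (1 - ε) * inner ℝ (c ℓ) ν ≤ (1 - ε) * b ℓ :=
        mul_le_mul_of_nonneg_left (hνC.2 ℓ) (by linarith)
      nlinarith [hδb ℓ]
  have := G.inner_le_meanMaxWeight q hx
  rw [inner_add_right, real_inner_smul_right q q, real_inner_self_eq_norm_sq] at this
  have e : ε * δ / ‖q‖ * ‖q‖ ^ 2 = ε * δ * ‖q‖ := by field_simp
  linarith

/-- The state space collapse: MaxWeight pushes the queue lengths towards the normal cone at `ν`, at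
a rate that does not depend on the distance `ε` of the load from capacity. -/
lemma IsHalfspaceRep.exists_drift_normalCone (hcb : G.IsHalfspaceRep c b) {ν : Vec n}
    (hν : ν ∈ G.capacityRegion)
    (hpos : ∀ ℓ ∈ G.facetsThrough c b ν, ∀ i, 0 < c ℓ i → 0 < ν i) :
    ∃ δ : ℝ, 0 < δ ∧ ∀ ε : ℝ, 0 < ε → ε < δ → ∀ q : Vec n, (∀ i, 0 ≤ q i) →
      inner ℝ (q - coneProj c (G.facetsThrough c b ν) q) ((1 - ε) • ν) - G.meanMaxWeight q
        + G.meanMaxWeight (coneProj c (G.facetsThrough c b ν) q)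
        ≤ -δ * ‖q - coneProj c (G.facetsThrough c b ν) q‖ := by
  set P := G.facetsThrough c b ν with hP
  have hνC := hcb.mem_iff.1 hν
  obtain ⟨δ₁, h₁, h₁b⟩ := exists_pos_forall_le
    (fun ℓ : {ℓ // ℓ ∉ P} => b ℓ - inner ℝ (c ℓ) ν) fun ℓ =>
      sub_pos.2 (lt_of_le_of_ne (hνC.2 ℓ) fun h => ℓ.2 ⟨hν, h⟩)
  obtain ⟨δ₂, h₂, h₂b⟩ := exists_pos_forall_le (fun i : {i // 0 < ν i} => ν i) fun i => i.2
  set δ₀ := min δ₁ δ₂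
  have h₀ : 0 < δ₀ := lt_min h₁ h₂
  have hν1 : 0 < 2 * (‖ν‖ + 1) := by positivity
  refine ⟨δ₀ / (2 * (‖ν‖ + 1)), by positivity, fun ε hε hεδ q hq => ?_⟩
  set p := coneProj c P q with hp
  have hpK : p ∈ normalCone c P := coneProj_mem q
  rw [hcb.meanMaxWeight_eq hν hpK]
  rcases eq_or_ne (q - p) 0 with h0 | h0
  · have := G.inner_le_meanMaxWeight q hν
    rw [h0, norm_zero, inner_zero_left, ← sub_eq_zero.1 h0]
    linarith
  have hn : 0 < ‖q - p‖ := norm_pos_iff.2 h0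
  have hx : ν + (δ₀ / ‖q - p‖) • (q - p) ∈ G.capacityRegion := by
    refine hcb.mem_iff.2 ⟨fun i => ?_, fun ℓ => ?_⟩
    · simp only [PiLp.add_apply, PiLp.smul_apply, smul_eq_mul]
      rcases (hνC.1 i).lt_or_eq with hi | hi
      · have e1 : δ₀ ≤ ν i := (min_le_right _ _).trans (h₂b ⟨i, hi⟩)
        have e2 : -‖q - p‖ ≤ (q - p) i := by
          have := PiLp.norm_apply_le (q - p) i
          rw [Real.norm_eq_abs] at this
          exact (abs_le.1 this).1
        have e3 : δ₀ / ‖q - p‖ * -‖q - p‖ ≤ δ₀ / ‖q - p‖ * (q - p) i := by gcongr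
        have e4 : δ₀ / ‖q - p‖ * -‖q - p‖ = -δ₀ := by field_simp
        linarith
      · -- where `ν` vanishes, so do all the vectors of the cone
        have : p i = 0 := apply_eq_zero_of_mem_normalCone hpK fun ℓ hℓ =>
          le_antisymm (not_lt.1 fun h => (hpos ℓ hℓ i h).ne hi) (hcb.c_nonneg ℓ i)
        rw [PiLp.sub_apply, this, ← hi]
        have := hq i
        simp only [sub_zero]
        positivity
    · rw [inner_add_right, real_inner_smul_right]
      by_cases hℓ : ℓ ∈ P
      · -- the residual of the projection is in the polar cone
        have := inner_sub_coneProj_le q (mem_normalCone_of_mem (c := c) hℓ)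
        rw [real_inner_comm] at this
        have := mul_nonpos_of_nonneg_of_nonpos (by positivity : 0 ≤ δ₀ / ‖q - p‖) this
        linarith [hνC.2 ℓ]
      · have e1 : inner ℝ (c ℓ) (q - p) ≤ ‖q - p‖ := by
          simpa [hcb.c_norm ℓ] using real_inner_le_norm (c ℓ) (q - p)
        have e2 : δ₀ / ‖q - p‖ * inner ℝ (c ℓ) (q - p) ≤ δ₀ := by
          calc _ ≤ δ₀ / ‖q - p‖ * ‖q - p‖ := by gcongr
            _ = δ₀ := by field_simp
        have : δ₀ ≤ _ := (min_le_left _ _).trans (h₁b ⟨ℓ, hℓ⟩)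
        linarith
  have hmax := G.inner_le_meanMaxWeight q hx
  rw [inner_add_right, real_inner_smul_right, hp, inner_coneProj_self, ← hp] at hmax
  have e : δ₀ / ‖q - p‖ * ‖q - p‖ ^ 2 = δ₀ * ‖q - p‖ := by field_simp
  have e1 : -(‖q - p‖ * ‖ν‖) ≤ inner ℝ (q - p) ν := (abs_le.1 (abs_real_inner_le_norm _ _)).1
  have e2 : inner ℝ (q - p) ν = inner ℝ q ν - inner ℝ p ν := inner_sub_left _ _ _
  have e3 : ε * (‖ν‖ + 1) ≤ δ₀ / 2 := by
    rw [lt_div_iff₀ hν1] at hεδ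
    linarith
  have e4 : δ₀ / (2 * (‖ν‖ + 1)) ≤ δ₀ / 2 := by
    gcongr
    linarith [norm_nonneg ν]
  have e5 := mul_le_mul_of_nonneg_right e3 hn.le
  have e6 := mul_le_mul_of_nonneg_right e4 hn.le
  have e7 := mul_le_mul_of_nonneg_left e1 hε.le
  have e8 := mul_pos hε hn
  rw [real_inner_smul_right]
  nlinarith

end

end GeneralizedSwitch

/-! ### One time slot of the switch -/

lemma integrable_of_bound {Ω : Type*} [MeasurableSpace Ω] {P : Measure Ω} [IsFiniteMeasure P]
    {f : Ω → ℝ} (hf : Measurable f) (h : ∃ R, ∀ᵐ ω ∂P, |f ω| ≤ R) : Integrable f P := by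
  obtain ⟨R, hR⟩ := h
  exact Integrable.of_bound hf.aestronglyMeasurable R hR

namespace GeneralizedSwitch

variable {n L : ℕ} {𝓜 : Type*}

/-- One time slot of the switch under MaxWeight, on a probability space on which the queue length
vector `q` at the start of the slot is bounded: channel state `M`, arrivals `a` with mean `lam`,
offered service `s`, unused service `u`, and queue length vector `q'` at the end of the slot. The
vectors `a`, `s`, `u` have norm at most `D`. -/
structure SwitchStep [MeasurableSpace 𝓜] (G : GeneralizedSwitch n 𝓜)
    {Ω : Type*} [MeasurableSpace Ω] (P : Measure Ω) (D : ℝ) (lam : Vec n)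
    (M : Ω → 𝓜) (a s u q q' : Ω → Vec n) : Prop where
  measurable_M : Measurable M
  measurable_a : Measurable a
  measurable_s : Measurable s
  measurable_u : Measurable u
  measurable_q : Measurable q
  measurable_q' : Measurable q'
  map_M : P.map M = G.ψ.toMeasure
  indep_M : IndepFun q M P
  indep_a : IndepFun (fun ω => (q ω, s ω)) a P
  mean_a : ∀ i, ∫ ω, a ω i ∂P = lam i
  maxWeight : ∀ᵐ ω ∂P, s ω ∈ G.maxWeightSchedules (q ω) (M ω)
  q_nonneg : ∀ᵐ ω ∂P, ∀ i, 0 ≤ q ω i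
  u_nonneg : ∀ᵐ ω ∂P, ∀ i, 0 ≤ u ω i
  evolution : ∀ᵐ ω ∂P, q' ω = q ω + a ω - s ω + u ω
  unused : ∀ᵐ ω ∂P, ∀ i, q' ω i * u ω i = 0
  norm_a_le : ∀ᵐ ω ∂P, ‖a ω‖ ≤ D
  norm_s_le : ∀ᵐ ω ∂P, ‖s ω‖ ≤ D
  norm_u_le : ∀ᵐ ω ∂P, ‖u ω‖ ≤ D
  bounded_q : ∃ R, ∀ᵐ ω ∂P, ‖q ω‖ ≤ R

namespace SwitchStep

variable [MeasurableSpace 𝓜] {G : GeneralizedSwitch n 𝓜}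
  {Ω : Type*} [MeasurableSpace Ω] {P : Measure Ω} {D : ℝ} {lam : Vec n}
  {M : Ω → 𝓜} {a s u q q' : Ω → Vec n}

lemma norm_increment_le (h : SwitchStep G P D lam M a s u q q') :
    ∀ᵐ ω ∂P, ‖q' ω - q ω‖ ≤ 3 * D := by
  filter_upwards [h.evolution, h.norm_a_le, h.norm_s_le, h.norm_u_le] with ω h1 h2 h3 h4
  have : q' ω - q ω = a ω - s ω + u ω := by rw [h1]; abel
  rw [this]
  exact (norm_add_le _ _).trans (by linarith [norm_sub_le (a ω) (s ω)])

lemma bounded_q' (h : SwitchStep G P D lam M a s u q q') : ∃ R, ∀ᵐ ω ∂P, ‖q' ω‖ ≤ R := by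
  obtain ⟨R, hR⟩ := h.bounded_q
  refine ⟨R + 3 * D, ?_⟩
  filter_upwards [hR, h.norm_increment_le] with ω h1 h2
  have := norm_add_le (q ω) (q' ω - q ω)
  rw [add_sub_cancel] at this
  linarith

lemma measurable_channel [Fintype 𝓜] [MeasurableSingletonClass 𝓜]
    (h : SwitchStep G P D lam M a s u q q') {F : 𝓜 → Vec n → ℝ} (hF : ∀ m, Measurable (F m)) :
    Measurable fun ω => F (M ω) (q ω) :=
  (measurable_from_prod_countable_right hF : Measurable fun x : 𝓜 × Vec n => F x.1 x.2).comp
    (h.measurable_M.prodMk h.measurable_q)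

lemma exists_bound_comp {f : Vec n → ℝ} (hf : Continuous f) {X : Ω → Vec n}
    (hX : ∃ R, ∀ᵐ ω ∂P, ‖X ω‖ ≤ R) : ∃ R, ∀ᵐ ω ∂P, |f (X ω)| ≤ R := by
  obtain ⟨R, hR⟩ := hX
  obtain ⟨C, hC⟩ :=
    (isCompact_closedBall (0 : Vec n) R).exists_bound_of_continuousOn hf.continuousOn
  exact ⟨C, hR.mono fun ω h => hC _ (by simpa using h)⟩

variable [IsProbabilityMeasure P]

lemma integrable_comp_q (h : SwitchStep G P D lam M a s u q q') {f : Vec n → ℝ}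
    (hf : Continuous f) : Integrable (fun ω => f (q ω)) P :=
  integrable_of_bound (hf.measurable.comp h.measurable_q) (exists_bound_comp hf h.bounded_q)

lemma integrable_comp_q' (h : SwitchStep G P D lam M a s u q q') {f : Vec n → ℝ}
    (hf : Continuous f) : Integrable (fun ω => f (q' ω)) P :=
  integrable_of_bound (hf.measurable.comp h.measurable_q') (exists_bound_comp hf h.bounded_q')

/-- The arrivals may be averaged out, since they are independent of queue lengths and service. -/
lemma integral_inner_arrival (h : SwitchStep G P D lam M a s u q q') {F : Vec n × Vec n → Vec n}
    (hF : Measurable F) (hb : ∃ R, ∀ᵐ ω ∂P, ‖F (q ω, s ω)‖ ≤ R) :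
    ∫ ω, inner ℝ (F (q ω, s ω)) (a ω) ∂P = ∫ ω, inner ℝ (F (q ω, s ω)) lam ∂P := by
  obtain ⟨R, hR⟩ := hb
  have hFm : Measurable fun ω => F (q ω, s ω) := hF.comp (h.measurable_q.prodMk h.measurable_s)
  have hcoord : ∀ i, Measurable fun x : Vec n => x i := fun i => by fun_prop
  have hFb : ∀ i, ∀ᵐ ω ∂P, |F (q ω, s ω) i| ≤ R := fun i =>
    hR.mono fun ω hω => (PiLp.norm_apply_le (F (q ω, s ω)) i).trans hω
  have hab : ∀ i, ∀ᵐ ω ∂P, |a ω i| ≤ D := fun i =>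
    h.norm_a_le.mono fun ω hω => (PiLp.norm_apply_le (a ω) i).trans hω
  simp only [PiLp.inner_apply, RCLike.inner_apply, conj_trivial]
  rw [integral_finsetSum _ fun i _ => integrable_of_bound ?_ ⟨D * R, ?_⟩,
    integral_finsetSum _ fun i _ => integrable_of_bound ?_ ⟨|lam i| * R, ?_⟩]
  · refine Finset.sum_congr rfl fun i _ => ?_
    rw [integral_const_mul, ← h.mean_a i]
    exact (h.indep_a.symm.integral_fun_comp_mul_comp (f := fun x : Vec n => x i)
      (g := fun x => F x i) h.measurable_a.aemeasurable
      (h.measurable_q.prodMk h.measurable_s).aemeasurable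
      (hcoord i).aestronglyMeasurable ((hcoord i).comp hF).aestronglyMeasurable)
  · exact measurable_const.mul ((hcoord _).comp hFm)
  · filter_upwards [hFb _] with ω h1
    rw [abs_mul]; gcongr
  · exact ((hcoord _).comp h.measurable_a).mul ((hcoord _).comp hFm)
  · filter_upwards [hFb _, hab _] with ω h1 h2
    rw [abs_mul]; gcongr; exact (abs_nonneg _).trans h2

variable [Fintype 𝓜] [MeasurableSingletonClass 𝓜]

/-- The channel state may be averaged out, since it is independent of the queue lengths. -/
lemma integral_channel (h : SwitchStep G P D lam M a s u q q') {F : 𝓜 → Vec n → ℝ}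
    (hF : ∀ m, Measurable (F m)) (hb : ∃ R, ∀ᵐ ω ∂P, ∀ m, |F m (q ω)| ≤ R) :
    ∫ ω, F (M ω) (q ω) ∂P = ∫ ω, ∑ m, (G.ψ m).toReal * F m (q ω) ∂P := by
  classical
  obtain ⟨R, hR⟩ := hb
  have hRm : ∀ m, ∀ᵐ ω ∂P, |F m (q ω)| ≤ R := fun m => hR.mono fun ω hω => hω m
  have hind : ∀ m : 𝓜, Measurable fun m' : 𝓜 => if m' = m then (1 : ℝ) else 0 := fun m =>
    measurable_of_countable _
  have hM : ∀ m, ∫ ω, (if M ω = m then (1 : ℝ) else 0) ∂P = (G.ψ m).toReal := fun m => by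
    rw [← integral_map (f := fun m' : 𝓜 => if m' = m then (1 : ℝ) else 0)
      h.measurable_M.aemeasurable (hind m).aestronglyMeasurable, h.map_M, PMF.integral_eq_sum]
    simp
  have hsum : ∀ ω, F (M ω) (q ω) = ∑ m, (if M ω = m then (1 : ℝ) else 0) * F m (q ω) := fun ω => by
    simp
  simp only [hsum]
  rw [integral_finsetSum _ fun m _ => integrable_of_bound ?_ ⟨1 * R, ?_⟩,
    integral_finsetSum _ fun m _ => integrable_of_bound ?_ ⟨|(G.ψ m).toReal| * R, ?_⟩]
  · refine Finset.sum_congr rfl fun m _ => ?_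
    rw [integral_const_mul, ← hM m]
    exact h.indep_M.symm.integral_fun_comp_mul_comp
      (f := fun m' : 𝓜 => if m' = m then (1 : ℝ) else 0) (g := F m) h.measurable_M.aemeasurable
      h.measurable_q.aemeasurable (hind m).aestronglyMeasurable (hF m).aestronglyMeasurable
  · exact measurable_const.mul ((hF _).comp h.measurable_q)
  · filter_upwards [hRm _] with ω h1
    rw [abs_mul]; gcongr
  · exact ((hind _).comp h.measurable_M).mul ((hF _).comp h.measurable_q)
  · filter_upwards [hRm _] with ω h1
    rw [abs_mul]; gcongr
    split_ifs <;> simp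

end SwitchStep

end GeneralizedSwitch

/-! ### Exponential moments from negative drift -/

/-- A pathwise drift inequality for the exponential of a non-negative quantity that moves from `z`
to `z'` by at most `3 * D`. In the application `x` has conditional mean at most `-δ * z`. The
exponent `θ = δ / (36 * D ^ 2)` makes the second-order term `(3 * θ * D) ^ 2` equal to
`θ * δ / 4`, and from the level `16 * D ^ 2 / δ` on the error `8 * D ^ 2 / z` is at most `δ / 2`. -/
lemma exp_le_of_increment {z z' x δ D : ℝ} (hδ : 0 < δ) (hδD : δ ≤ D)
    (hinc : |z' - z| ≤ 3 * D) (hx : z * (z' - z) ≤ x + 8 * D ^ 2) :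
    Real.exp (δ / (36 * D ^ 2) * z') ≤
      Real.exp (δ / (36 * D ^ 2) * z) * (1 + δ / (36 * D ^ 2) * δ * (3 / 4))
      + (if 16 * D ^ 2 / δ ≤ z then Real.exp (δ / (36 * D ^ 2) * z) * (δ / (36 * D ^ 2)) / z else 0)
        * x
      + Real.exp (δ / (36 * D ^ 2) * (16 * D ^ 2 / δ + 3 * D)) := by
  have hD : 0 < D := hδ.trans_le hδD
  set θ := δ / (36 * D ^ 2) with hθ
  have hθ0 : 0 < θ := by positivity
  set κ := 16 * D ^ 2 / δ with hκ
  have hκ0 : 0 < κ := by positivity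
  split_ifs with hzκ
  · have hz0 : 0 < z := hκ0.trans_le hzκ
    have h1 : θ * (3 * D) ≤ 1 := by
      rw [hθ, div_mul_eq_mul_div, div_le_one (by positivity)]
      nlinarith
    have h2 : |θ * (z' - z)| ≤ 1 := by
      rw [abs_mul, abs_of_pos hθ0]
      exact (mul_le_mul_of_nonneg_left hinc hθ0.le).trans h1
    have h3 := (abs_le.1 (Real.abs_exp_sub_one_sub_id_le h2)).2
    have h4 : (θ * (z' - z)) ^ 2 ≤ θ * δ / 4 := by
      have : (z' - z) ^ 2 ≤ (3 * D) ^ 2 := sq_le_sq' (abs_le.1 hinc).1 (abs_le.1 hinc).2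
      calc (θ * (z' - z)) ^ 2 = θ * (θ * (z' - z) ^ 2) := by ring
        _ ≤ θ * (θ * (3 * D) ^ 2) := by gcongr
        _ = θ * δ / 4 := by rw [hθ]; field_simp; ring
    have h5 : z' - z ≤ x / z + δ / 2 := by
      have e1 : 8 * D ^ 2 ≤ δ / 2 * z := by
        have := mul_le_mul_of_nonneg_left hzκ (by positivity : 0 ≤ δ / 2)
        have e : δ / 2 * κ = 8 * D ^ 2 := by rw [hκ]; field_simp; ring
        linarith
      have e2 : z' - z = z * (z' - z) / z := by field_simp
      have e3 : x / z + δ / 2 = (x + δ / 2 * z) / z := by field_simp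
      rw [e2, e3]
      gcongr
      linarith
    have h6 : Real.exp (θ * z') = Real.exp (θ * z) * Real.exp (θ * (z' - z)) := by
      rw [← Real.exp_add]; congr 1; ring
    have h7 : Real.exp (θ * (z' - z)) ≤ 1 + θ * δ * (3 / 4) + θ * (x / z) := by
      nlinarith [mul_le_mul_of_nonneg_left h5 hθ0.le]
    have h8 := mul_le_mul_of_nonneg_left h7 (Real.exp_pos (θ * z)).le
    have h9 : Real.exp (θ * z) * θ / z * x = Real.exp (θ * z) * (θ * (x / z)) := by
      field_simp
    rw [h6, h9]
    nlinarith [Real.exp_pos (θ * (κ + 3 * D))]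
  · have h1 : Real.exp (θ * z') ≤ Real.exp (θ * (κ + 3 * D)) := by
      have := (abs_le.1 hinc).2
      gcongr
      linarith
    have : 0 ≤ Real.exp (θ * z) * (1 + θ * δ * (3 / 4)) := by positivity
    linarith

namespace GeneralizedSwitch

namespace SwitchStep

variable {n L : ℕ} {𝓜 : Type*} [MeasurableSpace 𝓜] {G : GeneralizedSwitch n 𝓜}
  {Ω : Type*} [MeasurableSpace Ω] {P : Measure Ω} {D : ℝ} {lam : Vec n}
  {M : Ω → 𝓜} {a s u q q' : Ω → Vec n}

/-- The unused service can only decrease the distance to a set of non-negative vectors, up to a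
constant, since it is orthogonal to the new queue length vector. -/
lemma norm_sub_mul_increment_le (h : SwitchStep G P D lam M a s u q q') (hD : 0 ≤ D)
    {p : Vec n → Vec n} (hp0 : ∀ x i, 0 ≤ p x i) (hmin : ∀ x y, ‖x - p x‖ ≤ ‖x - p y‖) :
    ∀ᵐ ω ∂P, ‖q ω - p (q ω)‖ * (‖q' ω - p (q' ω)‖ - ‖q ω - p (q ω)‖) ≤
      (inner ℝ (q ω - p (q ω)) (a ω) - G.maxWeight (q ω) (M ω) + G.maxWeight (p (q ω)) (M ω))
        + 8 * D ^ 2 := by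
  filter_upwards [h.evolution, h.unused, h.u_nonneg, h.norm_u_le, h.norm_increment_le,
    h.maxWeight] with ω h1 h2 h3 h4 h5 h6
  set p' := p (q ω)
  have e1 : ‖q' ω - p (q' ω)‖ ^ 2 ≤ ‖q ω - p'‖ ^ 2 + 2 * inner ℝ (q ω - p') (q' ω - q ω)
      + (3 * D) ^ 2 := by
    have e : q' ω - p' = (q ω - p') + (q' ω - q ω) := by abel
    calc ‖q' ω - p (q' ω)‖ ^ 2 ≤ ‖q' ω - p'‖ ^ 2 := by gcongr; exact hmin _ _
      _ = ‖q ω - p'‖ ^ 2 + 2 * inner ℝ (q ω - p') (q' ω - q ω) + ‖q' ω - q ω‖ ^ 2 := by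
        rw [e, norm_add_sq_real]
      _ ≤ _ := by gcongr
  have e2 : inner ℝ (q' ω) (u ω) = 0 := by
    rw [PiLp.inner_apply]
    exact Finset.sum_eq_zero fun i _ => by simpa [mul_comm] using h2 i
  have e3 : 0 ≤ inner ℝ p' (u ω) := by
    rw [PiLp.inner_apply]
    exact Finset.sum_nonneg fun i _ => mul_nonneg (h3 i) (hp0 _ i)
  have e4 : -(3 * D * D) ≤ inner ℝ (q' ω - q ω) (u ω) := by
    refine le_trans (neg_le_neg ?_) (abs_le.1 (abs_real_inner_le_norm _ _)).1
    gcongr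
  have e5 : inner ℝ (q ω - p') (u ω) ≤ 3 * D * D := by
    have : q ω - p' = q' ω - (q' ω - q ω) - p' := by abel
    rw [this, inner_sub_left, inner_sub_left, e2]
    linarith
  have e6 : inner ℝ (q ω - p') (q' ω - q ω) = inner ℝ (q ω - p') (a ω)
      - inner ℝ (q ω - p') (s ω) + inner ℝ (q ω - p') (u ω) := by
    rw [h1, ← inner_sub_right, ← inner_add_right]
    congr 1
    abel
  have e7 : inner ℝ (q ω - p') (s ω) = G.maxWeight (q ω) (M ω) - inner ℝ p' (s ω) := by
    rw [inner_sub_left, G.inner_eq_maxWeight h6]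
  have e8 : inner ℝ p' (s ω) ≤ G.maxWeight p' (M ω) := G.inner_le_maxWeight _ h6.1
  nlinarith [sq_nonneg (‖q' ω - p (q' ω)‖ - ‖q ω - p'‖)]

variable [IsProbabilityMeasure P] [Fintype 𝓜] [MeasurableSingletonClass 𝓜]

/-- If MaxWeight pushes the queue lengths towards the range of `p` at rate `δ`, then an exponential
moment of the distance to it contracts in one slot, up to a constant. -/
lemma integral_exp_le (h : SwitchStep G P D lam M a s u q q') {δ : ℝ} (hδ : 0 < δ) (hδD : δ ≤ D)
    {p : Vec n → Vec n} (hp : Continuous p) (hp0 : ∀ x i, 0 ≤ p x i)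
    (hmin : ∀ x y, ‖x - p x‖ ≤ ‖x - p y‖)
    (hdrift : ∀ x : Vec n, (∀ i, 0 ≤ x i) → inner ℝ (x - p x) lam - G.meanMaxWeight x
      + G.meanMaxWeight (p x) ≤ -δ * ‖x - p x‖) :
    ∫ ω, Real.exp (δ / (36 * D ^ 2) * ‖q' ω - p (q' ω)‖) ∂P ≤
      (1 - δ / (36 * D ^ 2) * δ / 4) * ∫ ω, Real.exp (δ / (36 * D ^ 2) * ‖q ω - p (q ω)‖) ∂P
      + 2 * Real.exp (δ / (36 * D ^ 2) * (16 * D ^ 2 / δ + 3 * D)) := by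
  have hD : 0 < D := hδ.trans_le hδD
  have hpath := h.norm_sub_mul_increment_le hD.le hp0 hmin
  have hexp := fun {z z' x : ℝ} => exp_le_of_increment (z := z) (z' := z') (x := x) hδ hδD
  set θ := δ / (36 * D ^ 2) with hθ
  have hθ0 : 0 < θ := by positivity
  set κ := 16 * D ^ 2 / δ with hκ
  have hκ0 : 0 < κ := by positivity
  have hθδ : θ * δ ≤ 1 := by
    rw [hθ, div_mul_eq_mul_div, div_le_one (by positivity)]
    nlinarith
  set E := Real.exp (θ * (κ + 3 * D))
  -- the factor of the drift in `exp_le_of_increment`: it depends on the queue lengths only, so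
  -- that arrivals and channel states can be averaged out
  set W : Vec n → ℝ := fun x =>
    if κ ≤ ‖x - p x‖ then Real.exp (θ * ‖x - p x‖) * θ / ‖x - p x‖ else 0 with hW
  have hZc : Continuous fun x => ‖x - p x‖ := by fun_prop
  have hWm : Measurable W := by
    refine Measurable.ite (measurableSet_le measurable_const hZc.measurable) ?_ measurable_const
    exact ((by fun_prop : Continuous fun x => Real.exp (θ * ‖x - p x‖) * θ).measurable).div
      hZc.measurable
  have hW0 : ∀ x, 0 ≤ W x := fun x => by
    simp only [hW]; split_ifs <;> positivity
  have hWle : ∀ x, W x ≤ Real.exp (θ * ‖x - p x‖) * θ / κ := fun x => by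
    simp only [hW]; split_ifs <;> [gcongr; positivity]
  have hWb : ∀ {f : Vec n → ℝ}, Continuous f → ∃ R, ∀ᵐ ω ∂P, |W (q ω) * f (q ω)| ≤ R := by
    intro f hf
    obtain ⟨R, hR⟩ := exists_bound_comp
      (f := fun x => Real.exp (θ * ‖x - p x‖) * θ / κ * |f x|) (by fun_prop) h.bounded_q
    refine ⟨R, hR.mono fun ω hω => le_trans ?_ ((le_abs_self _).trans hω)⟩
    rw [abs_mul, abs_of_nonneg (hW0 _)]
    exact mul_le_mul_of_nonneg_right (hWle _) (abs_nonneg _)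
  have hWi : ∀ {f : Vec n → ℝ}, Continuous f → Integrable (fun ω => W (q ω) * f (q ω)) P :=
    fun hf => integrable_of_bound ((hWm.mul hf.measurable).comp h.measurable_q) (hWb hf)
  -- the part of the drift that is linear in the arrivals
  have hA : Integrable (fun ω => W (q ω) * inner ℝ (q ω - p (q ω)) (a ω)) P := by
    obtain ⟨R, hR⟩ := hWb hZc
    refine integrable_of_bound ((hWm.comp h.measurable_q).mul ?_) ⟨R * D, ?_⟩
    · exact (h.measurable_q.sub (hp.measurable.comp h.measurable_q)).inner h.measurable_a
    · filter_upwards [hR, h.norm_a_le] with ω h1 h2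
      rw [abs_mul, abs_of_nonneg (hW0 _)]
      rw [abs_mul, abs_of_nonneg (hW0 _), abs_norm] at h1
      calc _ ≤ W (q ω) * (‖q ω - p (q ω)‖ * ‖a ω‖) :=
            mul_le_mul_of_nonneg_left (abs_real_inner_le_norm _ _) (hW0 _)
        _ = W (q ω) * ‖q ω - p (q ω)‖ * ‖a ω‖ := by ring
        _ ≤ R * D := by
          gcongr
          exact (mul_nonneg (hW0 _) (norm_nonneg _)).trans h1
  have hAe : ∫ ω, W (q ω) * inner ℝ (q ω - p (q ω)) (a ω) ∂P
      = ∫ ω, W (q ω) * inner ℝ (q ω - p (q ω)) lam ∂P := by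
    have := h.integral_inner_arrival (F := fun x => W x.1 • (x.1 - p x.1))
      ((hWm.smul (by fun_prop : Continuous fun x => x - p x).measurable).comp measurable_fst) ?_
    · simpa only [real_inner_smul_left] using this
    · obtain ⟨R, hR⟩ := hWb hZc
      refine ⟨R, hR.mono fun ω hω => ?_⟩
      rwa [norm_smul, Real.norm_eq_abs, ← abs_norm (q ω - p (q ω)), ← abs_mul]
  -- the part of the drift that depends on the channel state
  have hBc : ∀ m, Continuous fun x => G.maxWeight (p x) m - G.maxWeight x m := fun m =>
    ((G.continuous_maxWeight m).comp hp).sub (G.continuous_maxWeight m)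
  have hBm : ∀ m, Measurable fun x => W x * (G.maxWeight (p x) m - G.maxWeight x m) := fun m =>
    hWm.mul (hBc m).measurable
  have hBb : ∃ R, ∀ᵐ ω ∂P, ∀ m,
      |W (q ω) * (G.maxWeight (p (q ω)) m - G.maxWeight (q ω) m)| ≤ R := by
    choose R hR using fun m => hWb (hBc m)
    refine ⟨∑ m, |R m|, ?_⟩
    filter_upwards [ae_all_iff.2 hR] with ω hω m
    exact ((hω m).trans (le_abs_self _)).trans
      (Finset.single_le_sum (f := fun m => |R m|) (fun _ _ => abs_nonneg _) (Finset.mem_univ m))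
  have hB : Integrable (fun ω => W (q ω) *
      (G.maxWeight (p (q ω)) (M ω) - G.maxWeight (q ω) (M ω))) P :=
    integrable_of_bound (h.measurable_channel hBm) (hBb.imp fun R hR => hR.mono fun ω hω => hω _)
  have hBe : ∫ ω, W (q ω) * (G.maxWeight (p (q ω)) (M ω) - G.maxWeight (q ω) (M ω)) ∂P
      = ∫ ω, W (q ω) * (G.meanMaxWeight (p (q ω)) - G.meanMaxWeight (q ω)) ∂P := by
    rw [h.integral_channel (F := fun m x => W x * (G.maxWeight (p x) m - G.maxWeight x m)) hBm hBb]
    refine integral_congr_ae (Eventually.of_forall fun ω => ?_)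
    simp only [meanMaxWeight, ← Finset.sum_sub_distrib, Finset.mul_sum]
    exact Finset.sum_congr rfl fun m _ => by ring
  have hBi : Integrable (fun ω => W (q ω) * (G.meanMaxWeight (p (q ω)) - G.meanMaxWeight (q ω)))
      P := hWi ((G.continuous_meanMaxWeight.comp hp).sub G.continuous_meanMaxWeight)
  have hAi : Integrable (fun ω => W (q ω) * inner ℝ (q ω - p (q ω)) lam) P :=
    hWi (f := fun x => inner ℝ (x - p x) lam) (by fun_prop)
  have hZi : Integrable (fun ω => Real.exp (θ * ‖q ω - p (q ω)‖)) P :=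
    h.integrable_comp_q (f := fun x => Real.exp (θ * ‖x - p x‖)) (by fun_prop)
  calc ∫ ω, Real.exp (θ * ‖q' ω - p (q' ω)‖) ∂P
      ≤ ∫ ω, (Real.exp (θ * ‖q ω - p (q ω)‖) * (1 + θ * δ * (3 / 4)) + E
          + (W (q ω) * inner ℝ (q ω - p (q ω)) (a ω)
          + W (q ω) * (G.maxWeight (p (q ω)) (M ω) - G.maxWeight (q ω) (M ω)))) ∂P := by
        refine integral_mono_ae
          (h.integrable_comp_q' (f := fun x => Real.exp (θ * ‖x - p x‖)) (by fun_prop))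
          (((hZi.mul_const _).add (integrable_const _)).add (hA.add hB)) ?_
        filter_upwards [hpath, h.norm_increment_le] with ω h1 h2
        have h3 : |‖q' ω - p (q' ω)‖ - ‖q ω - p (q ω)‖| ≤ 3 * D := by
          have e1 := hmin (q' ω) (q ω)
          have e2 := hmin (q ω) (q' ω)
          have e3 : ‖q' ω - p (q ω)‖ ≤ ‖q' ω - q ω‖ + ‖q ω - p (q ω)‖ :=
            norm_sub_le_norm_sub_add_norm_sub _ _ _
          have e4 : ‖q ω - p (q' ω)‖ ≤ ‖q ω - q' ω‖ + ‖q' ω - p (q' ω)‖ :=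
            norm_sub_le_norm_sub_add_norm_sub _ _ _
          rw [norm_sub_rev (q ω) (q' ω)] at e4
          rw [abs_le]; constructor <;> linarith
        have h4 := hexp h3 h1
        refine h4.trans (le_of_eq ?_)
        simp only [hW, E]
        ring
    _ = ∫ ω, (Real.exp (θ * ‖q ω - p (q ω)‖) * (1 + θ * δ * (3 / 4)) + E
          + (W (q ω) * inner ℝ (q ω - p (q ω)) lam
          + W (q ω) * (G.meanMaxWeight (p (q ω)) - G.meanMaxWeight (q ω)))) ∂P := by
        have hFi : Integrable (fun ω => Real.exp (θ * ‖q ω - p (q ω)‖)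
            * (1 + θ * δ * (3 / 4)) + E) P := (hZi.mul_const _).add (integrable_const _)
        refine (integral_add hFi (hA.add hB)).trans ?_
        refine Eq.trans ?_ (integral_add hFi (hAi.add hBi)).symm
        congr 1
        refine (integral_add hA hB).trans ?_
        rw [hAe, hBe]
        exact (integral_add hAi hBi).symm
    _ ≤ ∫ ω, ((1 - θ * δ / 4) * Real.exp (θ * ‖q ω - p (q ω)‖) + 2 * E) ∂P := by
        refine integral_mono_ae (((hZi.mul_const _).add (integrable_const _)).add (hAi.add hBi))
          ((hZi.const_mul _).add (integrable_const _)) ?_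
        filter_upwards [h.q_nonneg] with ω h1
        have h2 := mul_le_mul_of_nonneg_left (hdrift (q ω) h1) (hW0 (q ω))
        have h3 : Real.exp (θ * ‖q ω - p (q ω)‖) * (θ * δ)
            ≤ W (q ω) * (δ * ‖q ω - p (q ω)‖) + E := by
          by_cases hκZ : κ ≤ ‖q ω - p (q ω)‖
          · have hZ0 : 0 < ‖q ω - p (q ω)‖ := hκ0.trans_le hκZ
            have : W (q ω) * (δ * ‖q ω - p (q ω)‖)
                = Real.exp (θ * ‖q ω - p (q ω)‖) * (θ * δ) := by
              simp only [hW, if_pos hκZ]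
              field_simp
            rw [this]
            linarith [Real.exp_pos (θ * (κ + 3 * D))]
          · have e1 : W (q ω) * (δ * ‖q ω - p (q ω)‖) = 0 := by simp [hW, if_neg hκZ]
            have e2 : Real.exp (θ * ‖q ω - p (q ω)‖) ≤ E := by
              have : ‖q ω - p (q ω)‖ ≤ κ + 3 * D := by linarith
              simp only [E]
              gcongr
            rw [e1, zero_add]
            exact (mul_le_of_le_one_right (Real.exp_pos _).le hθδ).trans e2
        simp only at *
        nlinarith
    _ = _ := by
        refine (integral_add (hZi.const_mul _) (integrable_const _)).trans ?_
        rw [integral_const_mul]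
        simp

end SwitchStep

end GeneralizedSwitch

/-! ### The quadratic form of the projection onto the span of the facet normals -/

section ProjForm

variable {n L : ℕ}

/-- The bilinear form `⟨x, H y⟩`, where `H = C (Cᵀ C)⁻¹ Cᵀ`. If the vectors `c ℓ`, `ℓ ∈ J`, are
linearly independent, then `H` is the orthogonal projection onto their span. -/
noncomputable def projForm (c : Fin L → Vec n) (J : Finset (Fin L)) (x y : Vec n) : ℝ :=
  inner ℝ x (Matrix.toEuclideanLin (projMatrix c J) y)

variable (c : Fin L → Vec n) (J : Finset (Fin L))

lemma projForm_add_left (x y z : Vec n) :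
    projForm c J (x + y) z = projForm c J x z + projForm c J y z := inner_add_left _ _ _

lemma projForm_sub_left (x y z : Vec n) :
    projForm c J (x - y) z = projForm c J x z - projForm c J y z := inner_sub_left _ _ _

lemma projForm_add_right (x y z : Vec n) :
    projForm c J x (y + z) = projForm c J x y + projForm c J x z := by
  rw [projForm, map_add, inner_add_right]; rfl

lemma projForm_sub_right (x y z : Vec n) :
    projForm c J x (y - z) = projForm c J x y - projForm c J x z := by
  rw [projForm, map_sub, inner_sub_right]; rfl

lemma projForm_smul_right (r : ℝ) (x y : Vec n) :
    projForm c J x (r • y) = r * projForm c J x y := by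
  rw [projForm, map_smul, real_inner_smul_right]; rfl

lemma continuous_projForm_self : Continuous fun x : Vec n => projForm c J x x := by
  have : Continuous (Matrix.toEuclideanLin (projMatrix c J)) :=
    LinearMap.continuous_of_finiteDimensional _
  unfold projForm
  fun_prop

lemma projForm_eq_sum_entries (x y : Vec n) :
    projForm c J x y = ∑ i, ∑ j, projMatrix c J i j * (x i * y j) := by
  simp only [projForm, PiLp.inner_apply, RCLike.inner_apply, conj_trivial,
    Matrix.toLpLin_apply, Matrix.mulVec, dotProduct, Finset.sum_mul]
  refine Finset.sum_congr rfl fun i _ => Finset.sum_congr rfl fun j _ => by ring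

lemma projForm_eq_sum (x y : Vec n) :
    projForm c J x y = ∑ ℓ : J, ∑ ℓ' : J, ((colMatrix c J)ᵀ * colMatrix c J)⁻¹ ℓ ℓ' *
      (inner ℝ (c ℓ) x * inner ℝ (c ℓ') y) := by
  have hA : ∀ z : Vec n, (colMatrix c J)ᵀ *ᵥ z.ofLp = fun ℓ : J => inner ℝ (c ℓ) z := fun z => by
    ext ℓ
    simp only [Matrix.mulVec, dotProduct, colMatrix, Matrix.transpose_apply, Matrix.of_apply,
      PiLp.inner_apply, RCLike.inner_apply, conj_trivial]
    exact Finset.sum_congr rfl fun i _ => mul_comm _ _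
  have h : projForm c J x y = x.ofLp ⬝ᵥ (projMatrix c J *ᵥ y.ofLp) := by
    rw [projForm_eq_sum_entries]
    simp only [dotProduct, Matrix.mulVec, Finset.mul_sum]
    exact Finset.sum_congr rfl fun i _ => Finset.sum_congr rfl fun j _ => by ring
  rw [h, projMatrix, ← Matrix.mulVec_mulVec, ← Matrix.mulVec_mulVec, Matrix.dotProduct_mulVec,
    ← Matrix.mulVec_transpose, hA, hA]
  simp only [dotProduct, Matrix.mulVec, Finset.mul_sum]
  exact Finset.sum_congr rfl fun i _ => Finset.sum_congr rfl fun j _ => by ring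

variable {c J}

lemma gram_eq_inner (ℓ ℓ' : J) :
    ((colMatrix c J)ᵀ * colMatrix c J) ℓ ℓ' = inner ℝ (c ℓ) (c ℓ') := by
  simp only [Matrix.mul_apply, PiLp.inner_apply, RCLike.inner_apply, conj_trivial, colMatrix,
    Matrix.transpose_apply, Matrix.of_apply]
  exact Finset.sum_congr rfl fun i _ => mul_comm _ _

lemma isUnit_det_gram (hJ : LinearIndependent ℝ fun ℓ : J => c ℓ) :
    IsUnit ((colMatrix c J)ᵀ * colMatrix c J).det := by
  have h := (Matrix.posDef_gram_of_linearIndependent hJ (𝕜 := ℝ)).det_pos.ne'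
  rw [isUnit_iff_ne_zero]
  have e : (colMatrix c J)ᵀ * colMatrix c J = Matrix.gram ℝ fun ℓ : J => c ℓ := by
    ext ℓ ℓ'
    rw [gram_eq_inner, Matrix.gram_apply]
  rwa [e]

lemma projForm_comm (x y : Vec n) : projForm c J x y = projForm c J y x := by
  have hs : ∀ ℓ ℓ' : J, ((colMatrix c J)ᵀ * colMatrix c J)⁻¹ ℓ ℓ'
      = ((colMatrix c J)ᵀ * colMatrix c J)⁻¹ ℓ' ℓ := fun ℓ ℓ' => by
    have h : (((colMatrix c J)ᵀ * colMatrix c J)⁻¹)ᵀ = ((colMatrix c J)ᵀ * colMatrix c J)⁻¹ := by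
      rw [Matrix.transpose_nonsing_inv, Matrix.transpose_mul, Matrix.transpose_transpose]
    conv_lhs => rw [← h, Matrix.transpose_apply]
  rw [projForm_eq_sum, projForm_eq_sum, Finset.sum_comm]
  refine Finset.sum_congr rfl fun ℓ _ => Finset.sum_congr rfl fun ℓ' _ => ?_
  rw [hs]; ring

lemma projForm_add_self (x y : Vec n) : projForm c J (x + y) (x + y)
    = projForm c J x x + 2 * projForm c J x y + projForm c J y y := by
  rw [projForm_add_left, projForm_add_right, projForm_add_right, projForm_comm y x]
  ring

lemma projForm_sub_self (x y : Vec n) : projForm c J (x - y) (x - y)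
    = projForm c J x x - 2 * projForm c J x y + projForm c J y y := by
  rw [projForm_sub_left, projForm_sub_right, projForm_sub_right, projForm_comm y x]
  ring

lemma projForm_of_mem (hJ : LinearIndependent ℝ fun ℓ : J => c ℓ) (ℓ : J) (y : Vec n) :
    projForm c J (c ℓ) y = inner ℝ (c ℓ) y := by
  have h : ∀ ℓ' : J, ∑ ℓ'' : J, ((colMatrix c J)ᵀ * colMatrix c J)⁻¹ ℓ' ℓ''
      * inner ℝ (c ℓ'') (c ℓ) = (1 : Matrix J J ℝ) ℓ' ℓ := fun ℓ' => by
    rw [← Matrix.nonsing_inv_mul _ (isUnit_det_gram hJ), Matrix.mul_apply]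
    simp only [gram_eq_inner]
  rw [projForm_comm, projForm_eq_sum]
  have h2 : ∀ ℓ' : J, ∑ ℓ'' : J, ((colMatrix c J)ᵀ * colMatrix c J)⁻¹ ℓ' ℓ''
      * (inner ℝ (c ℓ') y * inner ℝ (c ℓ'') (c ℓ)) = inner ℝ (c ℓ') y * (1 : Matrix J J ℝ) ℓ' ℓ :=
    fun ℓ' => by
      rw [← h, Finset.mul_sum]
      exact Finset.sum_congr rfl fun _ _ => by ring
  rw [Finset.sum_congr rfl fun ℓ' _ => h2 ℓ']
  simp [Matrix.one_apply]

/-- On the normal cone the form is the inner product. -/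
lemma projForm_of_mem_normalCone {P : Set (Fin L)}
    (hJ : Maximal (fun J : Finset (Fin L) =>
      (∀ ℓ ∈ J, ℓ ∈ P) ∧ LinearIndependent ℝ fun ℓ : J => c ℓ) J)
    {p : Vec n} (hp : p ∈ normalCone c P) (y : Vec n) : projForm c J p y = inner ℝ p y := by
  have hspan : ∀ ℓ ∈ P, c ℓ ∈ Submodule.span ℝ (c '' (J : Set (Fin L))) := by
    intro ℓ hℓ
    by_contra hn
    have hJi : LinearIndepOn ℝ c (J : Set (Fin L)) := hJ.prop.2
    have h1 : LinearIndepOn ℝ c (insert ℓ J : Finset (Fin L)) := by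
      rw [Finset.coe_insert]
      exact hJi.insert hn
    have h2 := hJ.le_of_ge (y := insert ℓ J) ⟨fun ℓ' h => ?_, h1⟩ (Finset.subset_insert _ _)
    · exact hn (Submodule.subset_span ⟨ℓ, h2 (Finset.mem_insert_self _ _), rfl⟩)
    · rcases Finset.mem_insert.1 h with rfl | h
      exacts [hℓ, hJ.prop.1 _ h]
  have h0 : ∀ x ∈ Submodule.span ℝ (c '' (J : Set (Fin L))),
      inner ℝ x (Matrix.toEuclideanLin (projMatrix c J) y - y) = 0 := by
    intro x hx
    induction hx using Submodule.span_induction with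
    | mem x hx =>
      obtain ⟨ℓ, hℓ, rfl⟩ := hx
      rw [inner_sub_right, sub_eq_zero]
      exact projForm_of_mem hJ.prop.2 ⟨ℓ, hℓ⟩ y
    | zero => simp
    | add x z _ _ hx hz => rw [inner_add_left, hx, hz, add_zero]
    | smul r x _ hx => rw [real_inner_smul_left, hx, mul_zero]
  have := inner_eq_zero_of_mem_normalCone hp fun ℓ hℓ => h0 _ (hspan ℓ hℓ)
  rw [inner_sub_right, sub_eq_zero] at this
  exact this

lemma abs_projForm_le (hc : ∀ ℓ, ‖c ℓ‖ = 1) (x y : Vec n) :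
    |projForm c J x y| ≤ (∑ ℓ : J, ∑ ℓ' : J, |((colMatrix c J)ᵀ * colMatrix c J)⁻¹ ℓ ℓ'|)
      * (‖x‖ * ∑ ℓ ∈ J, |inner ℝ (c ℓ) y|) := by
  rw [projForm_eq_sum, Finset.sum_mul]
  refine (Finset.abs_sum_le_sum_abs _ _).trans (Finset.sum_le_sum fun ℓ _ => ?_)
  rw [Finset.sum_mul]
  refine (Finset.abs_sum_le_sum_abs _ _).trans (Finset.sum_le_sum fun ℓ' _ => ?_)
  rw [abs_mul, abs_mul]
  have h1 : |inner ℝ (c ℓ) x| ≤ ‖x‖ := by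
    simpa [hc] using abs_real_inner_le_norm (c ℓ) x
  gcongr
  exact Finset.single_le_sum (f := fun ℓ => |inner ℝ (c ℓ) y|) (fun _ _ => abs_nonneg _) ℓ'.2

lemma onesForm_eq_sum {ι : Type*} [Fintype ι] (A : Matrix ι ι ℝ) :
    onesForm A = ∑ i, ∑ j, A i j := by
  simp [onesForm, Matrix.mulVec, dotProduct]

end ProjForm

namespace GeneralizedSwitch

variable {n L : ℕ} {𝓜 : Type*} [Fintype 𝓜] [MeasurableSpace 𝓜] [MeasurableSingletonClass 𝓜]
  {G : GeneralizedSwitch n 𝓜} {c : Fin L → Vec n} {J : Finset (Fin L)}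

lemma onesForm_covB {b : Fin L → ℝ} (hb : ∀ ℓ ∈ J, G.meanMaxWeight (c ℓ) = b ℓ)
    (A : Matrix J J ℝ) :
    onesForm (A ⊙ G.covB c J) = ∑ m, (G.ψ m).toReal * ∑ ℓ : J, ∑ ℓ' : J, A ℓ ℓ' *
      ((G.maxWeight (c ℓ) m - b ℓ) * (G.maxWeight (c ℓ') m - b ℓ')) := by
  have hmean : ∀ ℓ : J, ∫ m, G.maxWeight (c ℓ) m ∂G.ψ.toMeasure = b ℓ := fun ℓ => by
    rw [PMF.integral_eq_sum, ← hb ℓ ℓ.2]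
    simp [meanMaxWeight]
  rw [onesForm_eq_sum]
  simp only [Matrix.hadamard_apply, covB, Matrix.of_apply, covariance, hmean,
    PMF.integral_eq_sum, smul_eq_mul, Finset.mul_sum]
  symm
  rw [Finset.sum_comm]
  refine Finset.sum_congr rfl fun ℓ _ => ?_
  rw [Finset.sum_comm]
  exact Finset.sum_congr rfl fun ℓ' _ => Finset.sum_congr rfl fun m _ => by ring

lemma onesForm_covMatrix {Ω : Type*} [MeasurableSpace Ω] {μ : Measure Ω} [IsProbabilityMeasure μ]
    {X : Ω → Vec n} (hX : Measurable X) {D : ℝ} (hD : ∀ᵐ ω ∂μ, ‖X ω‖ ≤ D) {lam : Vec n}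
    (hlam : ∀ i, ∫ ω, X ω i ∂μ = lam i) :
    onesForm (projMatrix c J ⊙ covMatrix μ X) = ∫ ω, projForm c J (X ω - lam) (X ω - lam) ∂μ := by
  simp only [projForm_eq_sum_entries]
  have hi : ∀ i j,
      Integrable (fun ω => projMatrix c J i j * ((X ω - lam) i * (X ω - lam) j)) μ := by
    intro i j
    refine (integrable_of_bound ?_ ⟨(D + ‖lam‖) * (D + ‖lam‖), ?_⟩).const_mul _
    · have : ∀ i, Measurable fun ω => (X ω - lam) i := fun i => by fun_prop
      exact (this i).mul (this j)
    · filter_upwards [hD] with ω hω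
      have h1 : ∀ i, |(X ω - lam) i| ≤ D + ‖lam‖ := fun i =>
        (PiLp.norm_apply_le (X ω - lam) i).trans ((norm_sub_le _ _).trans (by gcongr))
      rw [abs_mul]
      exact mul_le_mul (h1 i) (h1 j) (abs_nonneg _) ((abs_nonneg _).trans (h1 i))
  rw [integral_finsetSum _ fun i _ => integrable_finsetSum _ fun j _ => hi i j, onesForm_eq_sum]
  refine Finset.sum_congr rfl fun i _ => ?_
  rw [integral_finsetSum _ fun j _ => hi i j]
  refine Finset.sum_congr rfl fun j _ => ?_
  rw [integral_const_mul]
  simp [Matrix.hadamard_apply, covMatrix, covariance, hlam]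

end GeneralizedSwitch

/-! ### Pathwise error bounds -/

section Pathwise

variable {n L : ℕ} {c : Fin L → Vec n} {P : Set (Fin L)} {J F : Finset (Fin L)}

/-- The unused service enters the form only through the distance of the queue lengths to the cone:
on the coordinates on which the cone lives it is orthogonal to the queue lengths, and on the other
coordinates it is orthogonal to the cone. -/
lemma exists_abs_projForm_unused_le (hc : ∀ ℓ i, 0 ≤ c ℓ i) (hc1 : ∀ ℓ, ‖c ℓ‖ = 1)
    (hF : ∀ ℓ, ℓ ∈ F ↔ ℓ ∈ P)
    (hJ : Maximal (fun J : Finset (Fin L) =>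
      (∀ ℓ ∈ J, ℓ ∈ P) ∧ LinearIndependent ℝ fun ℓ : J => c ℓ) J) :
    ∃ C : ℝ, 0 ≤ C ∧ ∀ q u : Vec n, (∀ i, 0 ≤ u i) → (∀ i, q i * u i = 0) →
      |projForm c J q u| ≤ C * (‖q - coneProj c P q‖ * ∑ ℓ ∈ F, inner ℝ (c ℓ) u) := by
  set Γ := ∑ ℓ : J, ∑ ℓ' : J, |((colMatrix c J)ᵀ * colMatrix c J)⁻¹ ℓ ℓ'|
  have hΓ : 0 ≤ Γ := Finset.sum_nonneg fun _ _ => Finset.sum_nonneg fun _ _ => abs_nonneg _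
  obtain ⟨γ, hγ, hγc⟩ := exists_pos_forall_le
    (fun i : {i // 0 < ∑ ℓ ∈ F, c ℓ i} => ∑ ℓ ∈ F, c ℓ i) fun i => i.2
  refine ⟨γ⁻¹ + Γ, by positivity, fun q u hu hqu => ?_⟩
  have hsum : ∑ ℓ ∈ F, inner ℝ (c ℓ) u = ∑ i, (∑ ℓ ∈ F, c ℓ i) * u i := by
    simp only [PiLp.inner_apply, RCLike.inner_apply, conj_trivial, Finset.sum_mul]
    rw [Finset.sum_comm]
    exact Finset.sum_congr rfl fun i _ => Finset.sum_congr rfl fun ℓ _ => mul_comm _ _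
  have hcu : ∀ ℓ, 0 ≤ inner ℝ (c ℓ) u := fun ℓ => by
    rw [PiLp.inner_apply]
    exact Finset.sum_nonneg fun i _ => mul_nonneg (hu i) (hc ℓ i)
  set p := coneProj c P q with hp
  have hpK : p ∈ normalCone c P := coneProj_mem q
  have h1 : |inner ℝ p u| ≤ γ⁻¹ * (‖q - p‖ * ∑ ℓ ∈ F, inner ℝ (c ℓ) u) := by
    have : ∀ i, |p i * u i| ≤ γ⁻¹ * (‖q - p‖ * ((∑ ℓ ∈ F, c ℓ i) * u i)) := fun i => by
      have h0 : 0 ≤ ∑ ℓ ∈ F, c ℓ i := Finset.sum_nonneg fun ℓ _ => hc ℓ i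
      rcases h0.lt_or_eq with h | h
      · have e1 : p i * u i = -((q - p) i * u i) := by
          rw [PiLp.sub_apply, sub_mul, hqu]; ring
        rw [e1, abs_neg, abs_mul, abs_of_nonneg (hu i)]
        have e2 : |(q - p) i| ≤ ‖q - p‖ := PiLp.norm_apply_le (q - p) i
        have e3 : 1 ≤ γ⁻¹ * ∑ ℓ ∈ F, c ℓ i := by
          rw [← div_eq_inv_mul, one_le_div hγ]; exact hγc ⟨i, h⟩
        calc |(q - p) i| * u i ≤ ‖q - p‖ * u i := mul_le_mul_of_nonneg_right e2 (hu i)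
          _ ≤ ‖q - p‖ * u i * (γ⁻¹ * ∑ ℓ ∈ F, c ℓ i) :=
            le_mul_of_one_le_right (mul_nonneg (norm_nonneg _) (hu i)) e3
          _ = _ := by ring
      · have e0 := (Finset.sum_eq_zero_iff_of_nonneg fun ℓ _ => hc ℓ i).1 h.symm
        rw [apply_eq_zero_of_mem_normalCone hpK fun ℓ hℓ => e0 ℓ ((hF ℓ).2 hℓ), ← h]
        simp
    rw [PiLp.inner_apply, hsum, Finset.mul_sum, Finset.mul_sum]
    refine (Finset.abs_sum_le_sum_abs _ _).trans (Finset.sum_le_sum fun i _ => ?_)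
    simpa [mul_comm] using this i
  have h2 : |projForm c J (q - p) u| ≤ Γ * (‖q - p‖ * ∑ ℓ ∈ F, inner ℝ (c ℓ) u) := by
    refine (abs_projForm_le hc1 _ _).trans ?_
    have : ∑ ℓ ∈ J, |inner ℝ (c ℓ) u| ≤ ∑ ℓ ∈ F, inner ℝ (c ℓ) u := by
      simp only [fun ℓ => abs_of_nonneg (hcu ℓ)]
      exact Finset.sum_le_sum_of_subset_of_nonneg (fun ℓ hℓ => (hF ℓ).2 (hJ.prop.1 ℓ hℓ))
        fun _ _ _ => hcu _
    gcongr
  have h3 : projForm c J q u = inner ℝ p u + projForm c J (q - p) u := by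
    rw [projForm_sub_left, projForm_of_mem_normalCone hJ hpK]; ring
  rw [h3, add_mul]
  exact (abs_add_le _ _).trans (add_le_add h1 h2)

namespace GeneralizedSwitch

variable {𝓜 : Type*}

/-- A MaxWeight schedule that is optimal for all facet normals is optimal for every vector of the
cone. As there are finitely many schedules, the loss of any other schedule is at most a multiple of
its total loss for the facet normals. -/
lemma exists_maxWeight_coneProj_sub_le [Finite 𝓜] (G : GeneralizedSwitch n 𝓜)
    (hF : ∀ ℓ, ℓ ∈ F ↔ ℓ ∈ P) :
    ∃ C : ℝ, 0 ≤ C ∧ ∀ (q : Vec n) (m : 𝓜), ∀ x ∈ G.maxWeightSchedules q m,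
      G.maxWeight (coneProj c P q) m - inner ℝ (coneProj c P q) x ≤
        C * (‖q - coneProj c P q‖ * ∑ ℓ ∈ F, (G.maxWeight (c ℓ) m - inner ℝ (c ℓ) x)) := by
  obtain ⟨B, hB, hSB⟩ := G.exists_norm_service_le
  obtain ⟨γ, hγ, hγc⟩ := exists_pos_forall_le
    (fun y : {y : (Σ m, G.S m) // 0 < ∑ ℓ ∈ F, (G.maxWeight (c ℓ) y.1 - inner ℝ (c ℓ) y.2.1)} =>
      ∑ ℓ ∈ F, (G.maxWeight (c ℓ) y.1.1 - inner ℝ (c ℓ) y.1.2.1)) fun y => y.2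
  refine ⟨2 * B * γ⁻¹, by positivity, fun q m x hx => ?_⟩
  have hgap : ∀ ℓ, 0 ≤ G.maxWeight (c ℓ) m - inner ℝ (c ℓ) x := fun ℓ =>
    sub_nonneg.2 (G.inner_le_maxWeight _ hx.1)
  obtain ⟨y, hy, hpy⟩ := G.exists_maxWeight_eq (coneProj c P q) m
  rw [hpy, ← inner_sub_right]
  rcases (Finset.sum_nonneg fun ℓ (_ : ℓ ∈ F) => hgap ℓ).lt_or_eq with h | h
  · have e1 : inner ℝ (coneProj c P q) (y - x) ≤ ‖q - coneProj c P q‖ * (2 * B) := by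
      have e2 : inner ℝ (coneProj c P q) (y - x)
          = inner ℝ q (y - x) - inner ℝ (q - coneProj c P q) (y - x) := by
        rw [inner_sub_left]; ring
      have e3 : inner ℝ q (y - x) ≤ 0 := by
        rw [inner_sub_right]; linarith [hx.2 y hy]
      have e4 := (abs_le.1 (abs_real_inner_le_norm (q - coneProj c P q) (y - x))).1
      have e5 : ‖y - x‖ ≤ 2 * B := by
        linarith [norm_sub_le y x, hSB m y hy, hSB m x hx.1]
      have e6 := mul_le_mul_of_nonneg_left e5 (norm_nonneg (q - coneProj c P q))
      linarith
    have e3 : 1 ≤ γ⁻¹ * ∑ ℓ ∈ F, (G.maxWeight (c ℓ) m - inner ℝ (c ℓ) x) := by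
      rw [← div_eq_inv_mul, one_le_div hγ]; exact hγc ⟨⟨m, ⟨x, hx.1⟩⟩, h⟩
    calc _ ≤ ‖q - coneProj c P q‖ * (2 * B) := e1
      _ ≤ ‖q - coneProj c P q‖ * (2 * B)
          * (γ⁻¹ * ∑ ℓ ∈ F, (G.maxWeight (c ℓ) m - inner ℝ (c ℓ) x)) :=
        le_mul_of_one_le_right (by positivity) e3
      _ = _ := by ring
  · have e0 := (Finset.sum_eq_zero_iff_of_nonneg fun ℓ _ => hgap ℓ).1 h.symm
    rw [← h, mul_zero, mul_zero]
    refine coneProj_mem (c := c) (P := P) q _ fun ℓ hℓ => ?_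
    rw [inner_sub_right]
    linarith [e0 ℓ ((hF ℓ).2 hℓ), G.inner_le_maxWeight (c ℓ) hy]

end GeneralizedSwitch

end Pathwise

/-- If `Z` has an exponential moment and `Y` is a bounded variable with mean of order `ε`, then
`Z * Y` has mean of order `ε log (1/ε)`: truncate `Z` at the level `log (1/ε) / θ`. -/
lemma integral_mul_le_log {Ω : Type*} [MeasurableSpace Ω] {μ : Measure Ω} [IsProbabilityMeasure μ]
    {Z Y : Ω → ℝ} {θ A B K ε : ℝ} (hθ : 0 < θ) (hε : 0 < ε) (hε1 : ε ≤ Real.exp (-1))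
    (hY0 : ∀ᵐ ω ∂μ, 0 ≤ Y ω) (hYB : ∀ᵐ ω ∂μ, Y ω ≤ B)
    (hY : Integrable Y μ) (hYε : ∫ ω, Y ω ∂μ ≤ K * ε) (hZY : Integrable (fun ω => Z ω * Y ω) μ)
    (hZ : Integrable (fun ω => Real.exp (θ * Z ω)) μ) (hZA : ∫ ω, Real.exp (θ * Z ω) ∂μ ≤ A) :
    ∫ ω, Z ω * Y ω ∂μ ≤ (K + B * A) / θ * (ε * Real.log (1 / ε)) := by
  have hlog : 1 ≤ Real.log (1 / ε) := by
    rw [one_div, Real.log_inv]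
    have := Real.log_le_log hε hε1
    rw [Real.log_exp] at this
    linarith
  have hB : 0 ≤ B := by
    obtain ⟨ω, h1, h2⟩ := (hY0.and hYB).exists
    exact h1.trans h2
  have hA : 0 ≤ A := (integral_nonneg fun ω => (Real.exp_pos _).le).trans hZA
  set T := Real.log (1 / ε) / θ with hT
  have hpt : ∀ᵐ ω ∂μ, Z ω * Y ω ≤ T * Y ω + B * ε / θ * Real.exp (θ * Z ω) := by
    filter_upwards [hY0, hYB] with ω h0 h1
    have e1 : θ * Z ω - θ * T ≤ ε * Real.exp (θ * Z ω) := by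
      have e2 : ε * Real.exp (θ * Z ω) = Real.exp (θ * Z ω - θ * T) := by
        have : θ * T = - Real.log ε := by
          rw [hT, one_div, Real.log_inv]; field_simp
        rw [this, sub_neg_eq_add, Real.exp_add, Real.exp_log hε, mul_comm]
      rw [e2]
      linarith [Real.add_one_le_exp (θ * Z ω - θ * T)]
    have e3 : (Z ω - T) * Y ω ≤ ε * Real.exp (θ * Z ω) / θ * B := by
      have e4 : Z ω - T ≤ ε * Real.exp (θ * Z ω) / θ := by
        rw [le_div_iff₀ hθ]; linarith
      calc (Z ω - T) * Y ω ≤ ε * Real.exp (θ * Z ω) / θ * Y ω := by gcongr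
        _ ≤ _ := by gcongr
    have e5 : B * ε / θ * Real.exp (θ * Z ω) = ε * Real.exp (θ * Z ω) / θ * B := by ring
    rw [e5]
    linarith
  calc ∫ ω, Z ω * Y ω ∂μ ≤ ∫ ω, (T * Y ω + B * ε / θ * Real.exp (θ * Z ω)) ∂μ :=
        integral_mono_ae hZY ((hY.const_mul _).add (hZ.const_mul _)) hpt
    _ = T * ∫ ω, Y ω ∂μ + B * ε / θ * ∫ ω, Real.exp (θ * Z ω) ∂μ := by
        rw [integral_add (hY.const_mul _) (hZ.const_mul _), integral_const_mul, integral_const_mul]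
    _ ≤ T * (K * ε) + B * ε / θ * A := by
        have : 0 ≤ T := by positivity
        gcongr
    _ = (K * (ε * Real.log (1 / ε)) + B * A * (ε * 1)) / θ := by rw [hT]; ring
    _ ≤ (K * (ε * Real.log (1 / ε)) + B * A * (ε * Real.log (1 / ε))) / θ := by gcongr
    _ = _ := by ring

/-! ### The drift of the quadratic form in one slot -/

namespace GeneralizedSwitch

variable {n L : ℕ} {𝓜 : Type*}

/-- The quadratic form `(CᵀC)⁻¹` evaluated at the deviations `max_{x ∈ S m} ⟨c ℓ, x⟩ - b ℓ`. Its
mean over the channel states is `1ᵀ((CᵀC)⁻¹ ∘ Σ_B)1`, see `onesForm_covB`. -/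
noncomputable def channelForm (G : GeneralizedSwitch n 𝓜) (c : Fin L → Vec n) (b : Fin L → ℝ)
    (J : Finset (Fin L)) (m : 𝓜) : ℝ :=
  ∑ ℓ : J, ∑ ℓ' : J, ((colMatrix c J)ᵀ * colMatrix c J)⁻¹ ℓ ℓ' *
    ((G.maxWeight (c ℓ) m - b ℓ) * (G.maxWeight (c ℓ') m - b ℓ'))

/-- The part of the drift of the form that would remain if the offered service were optimal for all
facet normals. It depends on the queue lengths and the channel state only, and its mean over the
channel states vanishes. -/
noncomputable def facetDrift (G : GeneralizedSwitch n 𝓜) (c : Fin L → Vec n) (b : Fin L → ℝ)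
    (P : Set (Fin L)) (J : Finset (Fin L)) (ν : Vec n) (m : 𝓜) (q : Vec n) : ℝ :=
  inner ℝ (coneProj c P q) ν - G.maxWeight (coneProj c P q) m
    + ∑ ℓ : J, ∑ ℓ' : J, ((colMatrix c J)ᵀ * colMatrix c J)⁻¹ ℓ ℓ' *
      (inner ℝ (c ℓ) (q - coneProj c P q) * (b ℓ' - G.maxWeight (c ℓ') m))

/-- The total loss of the offered service `x` for the facet normals `c ℓ`, `ℓ ∈ F`. -/
noncomputable def totalGap (G : GeneralizedSwitch n 𝓜) (c : Fin L → Vec n) (F : Finset (Fin L))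
    (m : 𝓜) (x : Vec n) : ℝ :=
  ∑ ℓ ∈ F, (G.maxWeight (c ℓ) m - inner ℝ (c ℓ) x)

variable {G : GeneralizedSwitch n 𝓜} {c : Fin L → Vec n} {b : Fin L → ℝ}
  {J F : Finset (Fin L)} {ν : Vec n}

lemma gap_le_totalGap {m : 𝓜} {x : Vec n} (hx : x ∈ G.S m) {ℓ : Fin L} (hℓ : ℓ ∈ F) :
    G.maxWeight (c ℓ) m - inner ℝ (c ℓ) x ≤ G.totalGap c F m x :=
  Finset.single_le_sum (f := fun ℓ => G.maxWeight (c ℓ) m - inner ℝ (c ℓ) x)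
    (fun _ _ => sub_nonneg.2 (G.inner_le_maxWeight _ hx)) hℓ

lemma totalGap_nonneg {m : 𝓜} {x : Vec n} (hx : x ∈ G.S m) : 0 ≤ G.totalGap c F m x :=
  Finset.sum_nonneg fun _ _ => sub_nonneg.2 (G.inner_le_maxWeight _ hx)

lemma abs_double_sum_le {ι : Type*} [Fintype ι] (A f : ι → ι → ℝ) {r : ℝ}
    (h : ∀ i j, |f i j| ≤ r) : |∑ i, ∑ j, A i j * f i j| ≤ (∑ i, ∑ j, |A i j|) * r := by
  rw [Finset.sum_mul]
  refine (Finset.abs_sum_le_sum_abs _ _).trans (Finset.sum_le_sum fun i _ => ?_)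
  rw [Finset.sum_mul]
  refine (Finset.abs_sum_le_sum_abs _ _).trans (Finset.sum_le_sum fun j _ => ?_)
  rw [abs_mul]
  gcongr
  exact h i j

lemma continuous_facetDrift (T : Set (Fin L)) (ν : Vec n) (m : 𝓜) :
    Continuous (G.facetDrift c b T J ν m) := by
  have h1 := continuous_coneProj (c := c) (P := T)
  have h2 := (G.continuous_maxWeight m).comp h1
  unfold facetDrift
  simp only [Function.comp_def] at h2
  fun_prop

variable [Fintype 𝓜]

/-- The one-slot change of the quadratic form, up to terms that are small in mean. -/
lemma IsHalfspaceRep.exists_abs_drift_sub_le (hcb : G.IsHalfspaceRep c b)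
    (hF : ∀ ℓ, ℓ ∈ F ↔ ℓ ∈ G.facetsThrough c b ν)
    (hJ : Maximal (fun J : Finset (Fin L) =>
      (∀ ℓ ∈ J, ℓ ∈ G.facetsThrough c b ν) ∧ LinearIndependent ℝ fun ℓ : J => c ℓ) J) (D : ℝ) :
    ∃ C : ℝ, 0 ≤ C ∧ ∀ ε : ℝ, 0 < ε → ε < 1 → ∀ (m : 𝓜) (a s u q q' : Vec n),
      s ∈ G.maxWeightSchedules q m → ‖u‖ ≤ D → (∀ i, 0 ≤ u i) → (∀ i, q' i * u i = 0) →
      q' = q + a - s + u →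
      |projForm c J q' q' - projForm c J q q + 2 * ε * projForm c J q ν
          - projForm c J (a - (1 - ε) • ν) (a - (1 - ε) • ν) - G.channelForm c b J m
          - 2 * projForm c J q (a - (1 - ε) • ν)
          - 2 * projForm c J ((1 - ε) • ν - s) (a - (1 - ε) • ν)
          - 2 * G.facetDrift c b (G.facetsThrough c b ν) J ν m q|
        ≤ C * (‖q - coneProj c (G.facetsThrough c b ν) q‖ * G.totalGap c F m s
            + G.totalGap c F m s + ε
            + ‖q' - coneProj c (G.facetsThrough c b ν) q'‖ * ∑ ℓ ∈ F, inner ℝ (c ℓ) u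
            + ∑ ℓ ∈ F, inner ℝ (c ℓ) u) := by
  set P := G.facetsThrough c b ν with hP
  set Γ := ∑ ℓ : J, ∑ ℓ' : J, |((colMatrix c J)ᵀ * colMatrix c J)⁻¹ ℓ ℓ'| with hΓdef
  have hΓ : 0 ≤ Γ := Finset.sum_nonneg fun _ _ => Finset.sum_nonneg fun _ _ => abs_nonneg _
  obtain ⟨B, hB, hSB⟩ := G.exists_norm_service_le
  obtain ⟨CA, hCA, hA⟩ := exists_abs_projForm_unused_le hcb.c_nonneg hcb.c_norm hF hJ
  obtain ⟨CB, hCB, hB'⟩ := G.exists_maxWeight_coneProj_sub_le (c := c) hF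
  have hb0 : ∀ ℓ, 0 ≤ b ℓ := fun ℓ => (hcb.b_pos ℓ).le
  set bs := ∑ ℓ ∈ F, b ℓ with hbs
  have hbs0 : 0 ≤ bs := Finset.sum_nonneg fun ℓ _ => hb0 ℓ
  have hJF : ∀ ℓ ∈ J, ℓ ∈ F := fun ℓ hℓ => (hF ℓ).2 (hJ.prop.1 ℓ hℓ)
  set R := ‖ν‖ + bs + 2 * B with hR
  have hR0 : 0 ≤ R := by positivity
  refine ⟨2 * (CB + Γ) + Γ * R + Γ * R * bs + 2 * CA + Γ * |D|, by positivity,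
    fun ε hε hε1 m a s u q q' hs huD hu hqu hq' => ?_⟩
  have hgap0 : 0 ≤ G.totalGap c F m s := totalGap_nonneg hs.1
  have hcu : ∀ ℓ, 0 ≤ inner ℝ (c ℓ) u := fun ℓ => by
    rw [PiLp.inner_apply]
    exact Finset.sum_nonneg fun i _ => mul_nonneg (hu i) (hcb.c_nonneg ℓ i)
  have hU0 : 0 ≤ ∑ ℓ ∈ F, inner ℝ (c ℓ) u := Finset.sum_nonneg fun ℓ _ => hcu ℓ
  have hsB := hSB m s hs.1
  set lam := (1 - ε) • ν with hlam
  set p := coneProj c P q with hp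
  have hpK : p ∈ normalCone c P := coneProj_mem q
  -- the expansion of the form
  have hexpand : projForm c J q' q' = projForm c J q q + 2 * projForm c J q (a - s)
      + projForm c J (a - s) (a - s) + 2 * projForm c J q' u - projForm c J u u := by
    have e1 : q + (a - s) = q' - u := by rw [hq']; abel
    have e2 : projForm c J (q + (a - s)) (q + (a - s)) = projForm c J (q' - u) (q' - u) := by
      rw [e1]
    rw [projForm_add_self, projForm_sub_self q' u] at e2
    linarith
  have hqas : projForm c J q (a - s) = projForm c J q (a - lam) + projForm c J q (ν - s)
      - ε * projForm c J q ν := by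
    have : a - s = (a - lam) + (ν - s) - ε • ν := by rw [hlam, sub_smul, one_smul]; abel
    rw [this, projForm_sub_right, projForm_add_right, projForm_smul_right]
  have haa : projForm c J (a - s) (a - s) = projForm c J (a - lam) (a - lam)
      + 2 * projForm c J (lam - s) (a - lam) + projForm c J (lam - s) (lam - s) := by
    have : a - s = (a - lam) + (lam - s) := by abel
    rw [this, projForm_add_self, projForm_comm (a - lam) (lam - s)]
  -- the four error terms
  have h1 : |projForm c J q (ν - s) - G.facetDrift c b P J ν m q|
      ≤ (CB + Γ) * (‖q - p‖ * G.totalGap c F m s) := by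
    have e1 : projForm c J q (ν - s) - G.facetDrift c b P J ν m q
        = (G.maxWeight p m - inner ℝ p s)
          + ∑ ℓ : J, ∑ ℓ' : J, ((colMatrix c J)ᵀ * colMatrix c J)⁻¹ ℓ ℓ' *
            (inner ℝ (c ℓ) (q - p) * (G.maxWeight (c ℓ') m - inner ℝ (c ℓ') s)) := by
      have e2 : projForm c J q (ν - s) = inner ℝ p (ν - s) + projForm c J (q - p) (ν - s) := by
        rw [projForm_sub_left, projForm_of_mem_normalCone hJ hpK]; ring
      have e3 : projForm c J (q - p) (ν - s)
          = (∑ ℓ : J, ∑ ℓ' : J, ((colMatrix c J)ᵀ * colMatrix c J)⁻¹ ℓ ℓ' *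
            (inner ℝ (c ℓ) (q - p) * (b ℓ' - G.maxWeight (c ℓ') m)))
            + ∑ ℓ : J, ∑ ℓ' : J, ((colMatrix c J)ᵀ * colMatrix c J)⁻¹ ℓ ℓ' *
            (inner ℝ (c ℓ) (q - p) * (G.maxWeight (c ℓ') m - inner ℝ (c ℓ') s)) := by
        rw [projForm_eq_sum, ← Finset.sum_add_distrib]
        refine Finset.sum_congr rfl fun ℓ _ => ?_
        rw [← Finset.sum_add_distrib]
        refine Finset.sum_congr rfl fun ℓ' _ => ?_
        rw [inner_sub_right (c ℓ') ν s, (hJ.prop.1 _ ℓ'.2).2]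
        ring
      rw [e2, e3, facetDrift, inner_sub_right]
      ring
    rw [e1, add_mul]
    refine (abs_add_le _ _).trans (add_le_add ?_ (abs_double_sum_le _ _ fun ℓ ℓ' => ?_))
    · rw [abs_of_nonneg (sub_nonneg.2 (G.inner_le_maxWeight _ hs.1))]
      exact hB' q m s hs
    · rw [abs_mul, abs_of_nonneg (sub_nonneg.2 (G.inner_le_maxWeight _ hs.1))]
      have : |inner ℝ (c ℓ) (q - p)| ≤ ‖q - p‖ := by
        simpa [hcb.c_norm] using abs_real_inner_le_norm (c ℓ) (q - p)
      exact mul_le_mul this (gap_le_totalGap hs.1 (hJF _ ℓ'.2))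
        (sub_nonneg.2 (G.inner_le_maxWeight _ hs.1)) (norm_nonneg _)
  have h2 : |projForm c J (lam - s) (lam - s) - G.channelForm c b J m|
      ≤ Γ * (R * (G.totalGap c F m s + ε * bs)) := by
    have e1 : projForm c J (lam - s) (lam - s) - G.channelForm c b J m
        = ∑ ℓ : J, ∑ ℓ' : J, ((colMatrix c J)ᵀ * colMatrix c J)⁻¹ ℓ ℓ' *
          (inner ℝ (c ℓ) (lam - s) * inner ℝ (c ℓ') (lam - s)
            - (G.maxWeight (c ℓ) m - b ℓ) * (G.maxWeight (c ℓ') m - b ℓ')) := by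
      rw [projForm_eq_sum, channelForm, ← Finset.sum_sub_distrib]
      refine Finset.sum_congr rfl fun ℓ _ => ?_
      rw [← Finset.sum_sub_distrib]
      exact Finset.sum_congr rfl fun ℓ' _ => by ring
    rw [e1]
    refine abs_double_sum_le _ _ fun ℓ ℓ' => ?_
    have ht : ∀ ℓ : J, |inner ℝ (c ℓ) (lam - s) - (b ℓ - G.maxWeight (c ℓ) m)|
        ≤ G.totalGap c F m s + ε * bs := fun ℓ => by
      have e2 : inner ℝ (c ℓ) (lam - s) - (b ℓ - G.maxWeight (c ℓ) m)
          = (G.maxWeight (c ℓ) m - inner ℝ (c ℓ) s) - ε * b ℓ := by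
        rw [inner_sub_right, hlam, real_inner_smul_right, (hJ.prop.1 _ ℓ.2).2]
        ring
      have e3 : b ℓ ≤ bs := Finset.single_le_sum (fun ℓ _ => hb0 ℓ) (hJF _ ℓ.2)
      have e4 := gap_le_totalGap (c := c) hs.1 (hJF _ ℓ.2)
      have e5 := sub_nonneg.2 (G.inner_le_maxWeight (c ℓ) hs.1)
      have e6 := mul_le_mul_of_nonneg_left e3 hε.le
      have e7 := mul_nonneg hε.le (hb0 ℓ)
      rw [e2, abs_le]
      constructor <;> linarith
    have hn : ∀ ℓ : J, |inner ℝ (c ℓ) (lam - s)| ≤ ‖ν‖ + B := fun ℓ => by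
      have e2 : |inner ℝ (c ℓ) (lam - s)| ≤ ‖lam - s‖ := by
        simpa [hcb.c_norm] using abs_real_inner_le_norm (c ℓ) (lam - s)
      have e3 : ‖lam‖ ≤ ‖ν‖ := by
        rw [hlam, norm_smul, Real.norm_eq_abs, abs_of_nonneg (by linarith)]
        exact mul_le_of_le_one_left (norm_nonneg _) (by linarith)
      linarith [norm_sub_le lam s]
    have hm : ∀ ℓ : J, |b ℓ - G.maxWeight (c ℓ) m| ≤ bs + B := fun ℓ => by
      obtain ⟨y, hy, hyc⟩ := G.exists_maxWeight_eq (c ℓ) m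
      have e2 : |inner ℝ (c ℓ) y| ≤ B := by
        have := abs_real_inner_le_norm (c ℓ) y
        rw [hcb.c_norm, one_mul] at this
        exact this.trans (hSB m y hy)
      have e3 : b ℓ ≤ bs := Finset.single_le_sum (fun ℓ _ => hb0 ℓ) (hJF _ ℓ.2)
      have e4 := abs_sub (b ℓ) (G.maxWeight (c ℓ) m)
      rw [abs_of_nonneg (hb0 ℓ), hyc] at e4
      rw [hyc]
      linarith
    have e2 : inner ℝ (c ℓ) (lam - s) * inner ℝ (c ℓ') (lam - s)
            - (G.maxWeight (c ℓ) m - b ℓ) * (G.maxWeight (c ℓ') m - b ℓ')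
        = (inner ℝ (c ℓ) (lam - s) - (b ℓ - G.maxWeight (c ℓ) m)) * inner ℝ (c ℓ') (lam - s)
          + (b ℓ - G.maxWeight (c ℓ) m)
            * (inner ℝ (c ℓ') (lam - s) - (b ℓ' - G.maxWeight (c ℓ') m)) := by ring
    rw [e2]
    refine (abs_add_le _ _).trans ?_
    rw [abs_mul, abs_mul]
    have e0 : 0 ≤ G.totalGap c F m s + ε * bs := by positivity
    have e3 := mul_le_mul (ht ℓ) (hn ℓ') (abs_nonneg _) e0
    have e4 := mul_le_mul (hm ℓ) (ht ℓ') (abs_nonneg _) (by positivity)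
    rw [hR]
    nlinarith
  have h3 := hA q' u hu hqu
  have h4 : |projForm c J u u| ≤ Γ * (|D| * ∑ ℓ ∈ F, inner ℝ (c ℓ) u) := by
    refine (abs_projForm_le hcb.c_norm _ _).trans ?_
    have : ∑ ℓ ∈ J, |inner ℝ (c ℓ) u| ≤ ∑ ℓ ∈ F, inner ℝ (c ℓ) u := by
      simp only [fun ℓ => abs_of_nonneg (hcu ℓ)]
      exact Finset.sum_le_sum_of_subset_of_nonneg hJF fun _ _ _ => hcu _
    have hD := huD.trans (le_abs_self D)
    gcongr
  set X := projForm c J q (ν - s) - G.facetDrift c b P J ν m q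
  set Y := projForm c J (lam - s) (lam - s) - G.channelForm c b J m
  set Z := ‖q - p‖
  set Z' := ‖q' - coneProj c P q'‖
  set gap := G.totalGap c F m s
  set U := ∑ ℓ ∈ F, inner ℝ (c ℓ) u
  have hZ : 0 ≤ Z := norm_nonneg _
  have hZ' : 0 ≤ Z' := norm_nonneg _
  have e : projForm c J q' q' - projForm c J q q + 2 * ε * projForm c J q ν
          - projForm c J (a - lam) (a - lam) - G.channelForm c b J m
          - 2 * projForm c J q (a - lam) - 2 * projForm c J (lam - s) (a - lam)
          - 2 * G.facetDrift c b P J ν m q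
      = 2 * X + Y + 2 * projForm c J q' u - projForm c J u u := by
    rw [hexpand, hqas, haa]; ring
  have e' : |2 * X + Y + 2 * projForm c J q' u - projForm c J u u|
      ≤ 2 * |X| + |Y| + 2 * |projForm c J q' u| + |projForm c J u u| := by
    have t1 := abs_sub (2 * X + Y + 2 * projForm c J q' u) (projForm c J u u)
    have t2 := abs_add_le (2 * X + Y) (2 * projForm c J q' u)
    have t3 := abs_add_le (2 * X) Y
    rw [abs_mul, abs_two] at t2 t3
    linarith
  rw [e]
  refine e'.trans ?_
  have f1 : 0 ≤ Z * gap := by positivity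
  have f2 : 0 ≤ Z' * U := by positivity
  set k1 := CB + Γ
  set k2 := Γ * R
  set k3 := Γ * R * bs
  set k5 := Γ * |D|
  have g1 : 0 ≤ k1 := by positivity
  have g2 : 0 ≤ k2 := by positivity
  have g3 : 0 ≤ k3 := by positivity
  have g5 : 0 ≤ k5 := by positivity
  have hY : |Y| ≤ k2 * gap + k3 * ε := h2.trans (le_of_eq (by ring))
  have hUU : |projForm c J u u| ≤ k5 * U := h4.trans (le_of_eq (by ring))
  have m1 : ∀ {k x : ℝ}, 0 ≤ k → 0 ≤ x → 0 ≤ k * x := fun hk hx => mul_nonneg hk hx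
  linarith [m1 g1 f1, m1 g1 hgap0, m1 g1 hε.le, m1 g1 f2, m1 g1 hU0, m1 g2 f1, m1 g2 hgap0,
    m1 g2 hε.le, m1 g2 f2, m1 g2 hU0, m1 g3 f1, m1 g3 hgap0, m1 g3 hε.le, m1 g3 f2, m1 g3 hU0,
    m1 hCA f1, m1 hCA hgap0, m1 hCA hε.le, m1 hCA f2, m1 hCA hU0, m1 g5 f1, m1 g5 hgap0,
    m1 g5 hε.le, m1 g5 f2, m1 g5 hU0]

end GeneralizedSwitch

/-! ### The mean drift of the quadratic form in one slot -/

lemma integrable_projForm {n L : ℕ} (c : Fin L → Vec n) (J : Finset (Fin L)) {Ω : Type*}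
    [MeasurableSpace Ω] {P : Measure Ω} [IsFiniteMeasure P] {X Y : Ω → Vec n}
    (hX : Measurable X) (hY : Measurable Y) (hXb : ∃ R, ∀ᵐ ω ∂P, ‖X ω‖ ≤ R)
    (hYb : ∃ R, ∀ᵐ ω ∂P, ‖Y ω‖ ≤ R) : Integrable (fun ω => projForm c J (X ω) (Y ω)) P := by
  obtain ⟨R, hR⟩ := hXb
  obtain ⟨R', hR'⟩ := hYb
  simp only [projForm_eq_sum_entries]
  refine integrable_finsetSum _ fun i _ => integrable_finsetSum _ fun j _ =>
    (integrable_of_bound ?_ ⟨R * R', ?_⟩).const_mul _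
  · have h1 : Measurable fun ω => X ω i := by fun_prop
    have h2 : Measurable fun ω => Y ω j := by fun_prop
    exact h1.mul h2
  · filter_upwards [hR, hR'] with ω h1 h2
    rw [abs_mul]
    exact mul_le_mul ((PiLp.norm_apply_le (X ω) i).trans h1) ((PiLp.norm_apply_le (Y ω) j).trans h2)
      (abs_nonneg _) ((norm_nonneg _).trans h1)

namespace GeneralizedSwitch

variable {n L : ℕ} {𝓜 : Type*} [Fintype 𝓜] [MeasurableSpace 𝓜] [MeasurableSingletonClass 𝓜]

lemma sum_toReal_eq_one (G : GeneralizedSwitch n 𝓜) : ∑ m, (G.ψ m).toReal = 1 := by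
  have := PMF.integral_eq_sum G.ψ fun _ => (1 : ℝ)
  simpa using this.symm

namespace SwitchStep

variable {G : GeneralizedSwitch n 𝓜}
  {Ω : Type*} [MeasurableSpace Ω] {P : Measure Ω} [IsProbabilityMeasure P] {D : ℝ} {lam : Vec n}
  {M : Ω → 𝓜} {a s u q q' : Ω → Vec n} {c : Fin L → Vec n} {b : Fin L → ℝ}
  {J F : Finset (Fin L)}

lemma integrable_inner (v : Vec n) {X : Ω → Vec n} (hX : Measurable X)
    (hb : ∃ R, ∀ᵐ ω ∂P, ‖X ω‖ ≤ R) : Integrable (fun ω => inner ℝ v (X ω)) P :=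
  integrable_of_bound (by fun_prop) (exists_bound_comp (f := fun x => inner ℝ v x) (by fun_prop) hb)

lemma integrable_maxWeight (h : SwitchStep G P D lam M a s u q q') (v : Vec n) :
    Integrable (fun ω => G.maxWeight v (M ω)) P := by
  obtain ⟨R, hR⟩ := (Set.finite_range fun m => G.maxWeight v m).isBounded.exists_norm_le
  exact integrable_of_bound (h.measurable_channel (F := fun m _ => G.maxWeight v m)
    fun m => measurable_const) ⟨R, Eventually.of_forall fun ω => hR _ ⟨_, rfl⟩⟩

lemma integral_maxWeight (h : SwitchStep G P D lam M a s u q q') (v : Vec n) :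
    ∫ ω, G.maxWeight v (M ω) ∂P = G.meanMaxWeight v := by
  obtain ⟨R, hR⟩ := (Set.finite_range fun m => G.maxWeight v m).isBounded.exists_norm_le
  rw [h.integral_channel (F := fun m _ => G.maxWeight v m) (fun m => measurable_const)
    ⟨R, Eventually.of_forall fun ω m => hR _ ⟨_, rfl⟩⟩]
  simp [meanMaxWeight]

/-- The balance of work in the direction `v`: the mean loss of service plus the mean unused service
equals the slack of the arrival rate, up to the mean change of the queue lengths. -/
lemma integral_gap_add_integral_unused (h : SwitchStep G P D lam M a s u q q') (v : Vec n) :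
    ∫ ω, (G.maxWeight v (M ω) - inner ℝ v (s ω)) ∂P + ∫ ω, inner ℝ v (u ω) ∂P
      = G.meanMaxWeight v - inner ℝ v lam
        + (∫ ω, inner ℝ v (q' ω) ∂P - ∫ ω, inner ℝ v (q ω) ∂P) := by
  have hs := integrable_inner v h.measurable_s ⟨D, h.norm_s_le⟩
  have ha := integrable_inner v h.measurable_a ⟨D, h.norm_a_le⟩
  have hu := integrable_inner v h.measurable_u ⟨D, h.norm_u_le⟩
  have hq := integrable_inner v h.measurable_q h.bounded_q
  have e1 : ∫ ω, inner ℝ v (q' ω) ∂P = ∫ ω, inner ℝ v (q ω) ∂P + ∫ ω, inner ℝ v (a ω) ∂P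
      - ∫ ω, inner ℝ v (s ω) ∂P + ∫ ω, inner ℝ v (u ω) ∂P := by
    rw [← integral_add hq ha, ← integral_sub (by fun_prop) hs, ← integral_add (by fun_prop) hu]
    refine integral_congr_ae ?_
    filter_upwards [h.evolution] with ω hω
    simp only [hω, inner_add_right, inner_sub_right]
  have e2 : ∫ ω, inner ℝ v (a ω) ∂P = inner ℝ v lam := by
    rw [h.integral_inner_arrival (F := fun _ => v) measurable_const
      ⟨‖v‖, Eventually.of_forall fun _ => le_rfl⟩]
    simp
  rw [integral_sub (h.integrable_maxWeight v) hs, h.integral_maxWeight]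
  linarith

omit [Fintype 𝓜] [MeasurableSingletonClass 𝓜] in
/-- The centred arrivals are uncorrelated with queue lengths and service. -/
lemma integral_projForm_arrival (h : SwitchStep G P D lam M a s u q q') {X : Vec n × Vec n → Vec n}
    (hX : Continuous X) (hb : ∃ R, ∀ᵐ ω ∂P, ‖X (q ω, s ω)‖ ≤ R) :
    ∫ ω, projForm c J (X (q ω, s ω)) (a ω - lam) ∂P = 0 := by
  have hproj : Continuous (Matrix.toEuclideanLin (projMatrix c J)) :=
    LinearMap.continuous_of_finiteDimensional _
  have hm : Measurable fun ω => X (q ω, s ω) :=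
    hX.measurable.comp (h.measurable_q.prodMk h.measurable_s)
  have h1 := h.integral_inner_arrival (F := fun x => Matrix.toEuclideanLin (projMatrix c J) (X x))
    (hproj.comp hX).measurable ?_
  · have e : ∀ x y, inner ℝ (Matrix.toEuclideanLin (projMatrix c J) x) y = projForm c J x y :=
      fun x y => by rw [projForm_comm, projForm, real_inner_comm]
    simp only [e] at h1
    simp only [projForm_sub_right]
    rw [integral_sub, h1, sub_self]
    · exact integrable_projForm c J hm h.measurable_a hb ⟨D, h.norm_a_le⟩
    · exact integrable_projForm c J hm measurable_const hb
        ⟨‖lam‖, Eventually.of_forall fun _ => le_rfl⟩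
  · obtain ⟨R, hR⟩ := exists_bound_comp (f := fun x => ‖Matrix.toEuclideanLin (projMatrix c J) x‖)
      (by fun_prop) hb
    exact ⟨R, hR.mono fun ω hω => (le_abs_self _).trans hω⟩

omit [MeasurableSingletonClass 𝓜] [IsProbabilityMeasure P] in
lemma exists_abs_facetDrift_le (h : SwitchStep G P D lam M a s u q q') (T : Set (Fin L))
    (ν : Vec n) : ∃ R, ∀ᵐ ω ∂P, ∀ m, |G.facetDrift c b T J ν m (q ω)| ≤ R := by
  choose R hR using fun m => exists_bound_comp
    (continuous_facetDrift (G := G) (c := c) (b := b) (J := J) T ν m) h.bounded_q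
  refine ⟨∑ m, |R m|, ?_⟩
  filter_upwards [ae_all_iff.2 hR] with ω hω m
  exact ((hω m).trans (le_abs_self _)).trans
    (Finset.single_le_sum (f := fun m => |R m|) (fun _ _ => abs_nonneg _) (Finset.mem_univ m))

lemma integral_facetDrift (h : SwitchStep G P D lam M a s u q q') (hcb : G.IsHalfspaceRep c b)
    {ν : Vec n} (hν : ν ∈ G.capacityRegion) (hJ : ∀ ℓ ∈ J, G.meanMaxWeight (c ℓ) = b ℓ) :
    ∫ ω, G.facetDrift c b (G.facetsThrough c b ν) J ν (M ω) (q ω) ∂P = 0 := by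
  rw [h.integral_channel (fun m => (continuous_facetDrift _ ν m).measurable)
    (h.exists_abs_facetDrift_le _ ν)]
  refine integral_eq_zero_of_ae (Eventually.of_forall fun ω => ?_)
  set p := coneProj c (G.facetsThrough c b ν) (q ω) with hp
  have h1 : ∑ m, (G.ψ m).toReal * (inner ℝ p ν - G.maxWeight p m) = 0 := by
    simp only [mul_sub, Finset.sum_sub_distrib, ← Finset.sum_mul, sum_toReal_eq_one, one_mul]
    have := hcb.meanMaxWeight_eq hν (coneProj_mem (c := c) (P := G.facetsThrough c b ν) (q ω))
    rw [meanMaxWeight] at this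
    rw [this, sub_self]
  have h2 : ∀ ℓ ∈ J, ∑ m, (G.ψ m).toReal * (b ℓ - G.maxWeight (c ℓ) m) = 0 := fun ℓ hℓ => by
    simp only [mul_sub, Finset.sum_sub_distrib, ← Finset.sum_mul, sum_toReal_eq_one, one_mul]
    have := hJ ℓ hℓ
    rw [meanMaxWeight] at this
    rw [this, sub_self]
  simp only [facetDrift, mul_add, Finset.sum_add_distrib, Finset.mul_sum, Pi.zero_apply]
  rw [← hp, h1, zero_add, Finset.sum_comm]
  refine Finset.sum_eq_zero fun ℓ _ => ?_
  rw [Finset.sum_comm]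
  refine Finset.sum_eq_zero fun ℓ' _ => ?_
  calc _ = ∑ m, ((colMatrix c J)ᵀ * colMatrix c J)⁻¹ ℓ ℓ' * inner ℝ (c ℓ) (q ω - p)
        * ((G.ψ m).toReal * (b ℓ' - G.maxWeight (c ℓ') m)) :=
        Finset.sum_congr rfl fun m _ => by ring
    _ = 0 := by rw [← Finset.mul_sum, h2 ℓ' ℓ'.2, mul_zero]

lemma integrable_channelForm (h : SwitchStep G P D lam M a s u q q') :
    Integrable (fun ω => G.channelForm c b J (M ω)) P := by
  obtain ⟨R, hR⟩ := (Set.finite_range fun m => G.channelForm c b J m).isBounded.exists_norm_le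
  exact integrable_of_bound (h.measurable_channel (F := fun m _ => G.channelForm c b J m)
    fun m => measurable_const) ⟨R, Eventually.of_forall fun ω => hR _ ⟨_, rfl⟩⟩

lemma integral_channelForm (h : SwitchStep G P D lam M a s u q q')
    (hJ : ∀ ℓ ∈ J, G.meanMaxWeight (c ℓ) = b ℓ) :
    ∫ ω, G.channelForm c b J (M ω) ∂P
      = onesForm (((colMatrix c J)ᵀ * colMatrix c J)⁻¹ ⊙ G.covB c J) := by
  obtain ⟨R, hR⟩ := (Set.finite_range fun m => G.channelForm c b J m).isBounded.exists_norm_le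
  rw [h.integral_channel (F := fun m _ => G.channelForm c b J m) (fun m => measurable_const)
    ⟨R, Eventually.of_forall fun ω m => hR _ ⟨_, rfl⟩⟩, onesForm_covB hJ]
  simp [channelForm]

/-- The mean of the one-slot change of the quadratic form; the terms of mean zero are included so
that `IsHalfspaceRep.exists_abs_drift_sub_le` bounds the integrand. -/
lemma integral_drift_eq {ε : ℝ} {ν : Vec n} (h : SwitchStep G P D ((1 - ε) • ν) M a s u q q')
    (hcb : G.IsHalfspaceRep c b) (hν : ν ∈ G.capacityRegion)
    (hbJ : ∀ ℓ ∈ J, G.meanMaxWeight (c ℓ) = b ℓ) :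
    ∫ ω, (projForm c J (q' ω) (q' ω) - projForm c J (q ω) (q ω)
          + 2 * ε * projForm c J (q ω) ν
          - projForm c J (a ω - (1 - ε) • ν) (a ω - (1 - ε) • ν)
          - G.channelForm c b J (M ω) - 2 * projForm c J (q ω) (a ω - (1 - ε) • ν)
          - 2 * projForm c J ((1 - ε) • ν - s ω) (a ω - (1 - ε) • ν)
          - 2 * G.facetDrift c b (G.facetsThrough c b ν) J ν (M ω) (q ω)) ∂P
      = (∫ ω, projForm c J (q' ω) (q' ω) ∂P - ∫ ω, projForm c J (q ω) (q ω) ∂P)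
        + 2 * ε * ∫ ω, projForm c J (q ω) ν ∂P
        - ∫ ω, projForm c J (a ω - (1 - ε) • ν) (a ω - (1 - ε) • ν) ∂P
        - onesForm (((colMatrix c J)ᵀ * colMatrix c J)⁻¹ ⊙ G.covB c J) := by
  set T := G.facetsThrough c b ν with hT
  set lam := (1 - ε) • ν
  have hlamb : ∃ R, ∀ᵐ ω ∂P, ‖a ω - lam‖ ≤ R :=
    ⟨D + ‖lam‖, h.norm_a_le.mono fun ω hω => (norm_sub_le _ _).trans (by gcongr)⟩
  have hlsb : ∃ R, ∀ᵐ ω ∂P, ‖lam - s ω‖ ≤ R :=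
    ⟨‖lam‖ + D, h.norm_s_le.mono fun ω hω => (norm_sub_le _ _).trans (by gcongr)⟩
  have ham : Measurable fun ω => a ω - lam := h.measurable_a.sub_const _
  have hsm : Measurable fun ω => lam - s ω := h.measurable_s.const_sub _
  have i1 := integrable_projForm c J h.measurable_q' h.measurable_q' h.bounded_q' h.bounded_q'
  have i2 := integrable_projForm c J h.measurable_q h.measurable_q h.bounded_q h.bounded_q
  have i3 := integrable_projForm c J (P := P) (Y := fun _ => ν) h.measurable_q measurable_const
    h.bounded_q ⟨‖ν‖, Eventually.of_forall fun _ => le_rfl⟩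
  have i4 := integrable_projForm c J ham ham hlamb hlamb
  have i5 := h.integrable_channelForm (c := c) (b := b) (J := J)
  have i6 := integrable_projForm c J h.measurable_q ham h.bounded_q hlamb
  have i7 := integrable_projForm c J hsm ham hlsb hlamb
  have i8 : Integrable (fun ω => G.facetDrift c b T J ν (M ω) (q ω)) P :=
    integrable_of_bound (h.measurable_channel fun m => (continuous_facetDrift T ν m).measurable)
      ((h.exists_abs_facetDrift_le T ν).imp fun R hR => hR.mono fun ω hω => hω _)
  have z6 := h.integral_projForm_arrival (c := c) (J := J) (X := fun x => x.1) continuous_fst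
    h.bounded_q
  have z7 := h.integral_projForm_arrival (c := c) (J := J) (X := fun x => lam - x.2)
    (by fun_prop) hlsb
  have z8 := h.integral_facetDrift (J := J) hcb hν hbJ
  rw [← hT] at z8
  rw [integral_sub (by fun_prop) (by fun_prop), integral_sub (by fun_prop) (by fun_prop),
    integral_sub (by fun_prop) (by fun_prop), integral_sub (by fun_prop) (by fun_prop),
    integral_sub (by fun_prop) (by fun_prop), integral_add (by fun_prop) (by fun_prop),
    integral_sub (by fun_prop) (by fun_prop)]
  simp only [integral_const_mul, z6, z7, z8, mul_zero, sub_zero, h.integral_channelForm hbJ]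

omit [MeasurableSingletonClass 𝓜] in
/-- On the intersection of the facets, the queue lengths in the direction `w` agree with the form up
to the distance of the queue lengths to the cone. -/
lemma abs_integral_inner_sub_le {ν w : Vec n} (h : SwitchStep G P D lam M a s u q q')
    (hcb : G.IsHalfspaceRep c b) (hν : ν ∈ G.capacityRegion)
    (hJ : Maximal (fun J : Finset (Fin L) =>
      (∀ ℓ ∈ J, ℓ ∈ G.facetsThrough c b ν) ∧ LinearIndependent ℝ fun ℓ : J => c ℓ) J)
    {θ A W : ℝ} (hθ : 0 < θ)
    (hA : ∫ ω, Real.exp (θ * ‖q ω - coneProj c (G.facetsThrough c b ν) (q ω)‖) ∂P ≤ A)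
    (hW : ∀ x ∈ G.capacityRegion, ‖x‖ ≤ W)
    (hwF : ∀ ℓ ∈ G.facetsThrough c b ν, w ∈ G.facet c b ℓ) (hw : w ∈ G.capacityRegion) :
    |∫ ω, inner ℝ (q ω) w ∂P - ∫ ω, projForm c J (q ω) ν ∂P| ≤
      (W + (∑ ℓ : J, ∑ ℓ' : J, |((colMatrix c J)ᵀ * colMatrix c J)⁻¹ ℓ ℓ'|) * (J.card * W))
        * (A / θ) := by
  set T := G.facetsThrough c b ν with hT
  set p : Vec n → Vec n := coneProj c T with hp
  have hpc : Continuous p := continuous_coneProj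
  set Γ := ∑ ℓ : J, ∑ ℓ' : J, |((colMatrix c J)ᵀ * colMatrix c J)⁻¹ ℓ ℓ'| with hΓdef
  have hΓ : 0 ≤ Γ := Finset.sum_nonneg fun _ _ => Finset.sum_nonneg fun _ _ => abs_nonneg _
  have hW0 : 0 ≤ W := (norm_nonneg _).trans (hW ν hν)
  have i3 := integrable_projForm c J (P := P) (Y := fun _ => ν) h.measurable_q measurable_const
    h.bounded_q ⟨‖ν‖, Eventually.of_forall fun _ => le_rfl⟩
  have iw : Integrable (fun ω => inner ℝ (q ω) w) P :=
    h.integrable_comp_q (f := fun x => inner ℝ x w) (by fun_prop)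
  have iZ : Integrable (fun ω => Real.exp (θ * ‖q ω - p (q ω)‖)) P :=
    h.integrable_comp_q (f := fun x => Real.exp (θ * ‖x - p x‖)) (by fun_prop)
  rw [← integral_sub iw i3]
  refine abs_integral_le_integral_abs.trans ?_
  calc ∫ ω, |inner ℝ (q ω) w - projForm c J (q ω) ν| ∂P
      ≤ ∫ ω, (W + Γ * (J.card * W)) * (Real.exp (θ * ‖q ω - p (q ω)‖) / θ) ∂P := by
        refine integral_mono (iw.sub i3).abs ((iZ.div_const _).const_mul _) fun ω => ?_
        have hpK : p (q ω) ∈ normalCone c T := coneProj_mem _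
        have e1 : inner ℝ (q ω) w - projForm c J (q ω) ν
            = inner ℝ (q ω - p (q ω)) w - projForm c J (q ω - p (q ω)) ν := by
          have : inner ℝ (p (q ω)) (w - ν) = 0 := inner_eq_zero_of_mem_normalCone hpK
            fun ℓ hℓ => by rw [inner_sub_right, (hwF ℓ hℓ).2, hℓ.2, sub_self]
          rw [inner_sub_right] at this
          rw [projForm_sub_left, inner_sub_left, projForm_of_mem_normalCone hJ hpK]
          linarith
        have e2 : |inner ℝ (q ω - p (q ω)) w| ≤ ‖q ω - p (q ω)‖ * W :=
          (abs_real_inner_le_norm _ _).trans (by gcongr; exact hW w hw)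
        have e3 : |projForm c J (q ω - p (q ω)) ν| ≤ Γ * (‖q ω - p (q ω)‖ * (J.card * W)) := by
          refine (abs_projForm_le hcb.c_norm _ _).trans ?_
          gcongr
          rw [← nsmul_eq_mul]
          refine Finset.sum_le_card_nsmul _ _ _ fun ℓ _ => ?_
          have := abs_real_inner_le_norm (c ℓ) ν
          rw [hcb.c_norm, one_mul] at this
          exact this.trans (hW ν hν)
        have e4 : ‖q ω - p (q ω)‖ ≤ Real.exp (θ * ‖q ω - p (q ω)‖) / θ := by
          rw [le_div_iff₀ hθ]
          linarith [Real.add_one_le_exp (θ * ‖q ω - p (q ω)‖)]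
        have e5 : 0 ≤ W + Γ * (J.card * W) := by positivity
        have e6 := mul_le_mul_of_nonneg_left e4 e5
        simp only
        rw [e1]
        refine (abs_sub _ _).trans ?_
        linarith
    _ = (W + Γ * (J.card * W)) * ((∫ ω, Real.exp (θ * ‖q ω - p (q ω)‖) ∂P) / θ) := by
        rw [integral_const_mul, integral_div]
    _ ≤ (W + Γ * (J.card * W)) * (A / θ) := by
        gcongr

end SwitchStep

/-- The heavy-traffic estimate in one slot: if the queue lengths are near the cone, in the sense of
an exponential moment, and almost stationary, then their mean in the direction `w` is determined up
to an error of order `log (1/ε)`. -/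
theorem IsHalfspaceRep.exists_heavyTraffic_bound {G : GeneralizedSwitch n 𝓜}
    {c : Fin L → Vec n} {b : Fin L → ℝ} {J : Finset (Fin L)} {ν : Vec n}
    (hcb : G.IsHalfspaceRep c b) (hν : ν ∈ G.capacityRegion)
    (hJ : Maximal (fun J : Finset (Fin L) =>
      (∀ ℓ ∈ J, ℓ ∈ G.facetsThrough c b ν) ∧ LinearIndependent ℝ fun ℓ : J => c ℓ) J)
    (D A : ℝ) {θ : ℝ} (hθ : 0 < θ) :
    ∃ β : ℝ, ∀ ε : ℝ, 0 < ε → ε ≤ Real.exp (-1) →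
      ∀ (Ω : Type*) [MeasurableSpace Ω] (P : Measure Ω) [IsProbabilityMeasure P]
        (M : Ω → 𝓜) (a s u q q' : Ω → Vec n), SwitchStep G P D ((1 - ε) • ν) M a s u q q' →
      ∫ ω, Real.exp (θ * ‖q ω - coneProj c (G.facetsThrough c b ν) (q ω)‖) ∂P ≤ A →
      ∫ ω, Real.exp (θ * ‖q' ω - coneProj c (G.facetsThrough c b ν) (q' ω)‖) ∂P ≤ A →
      (∀ ℓ, |∫ ω, inner ℝ (c ℓ) (q' ω) ∂P - ∫ ω, inner ℝ (c ℓ) (q ω) ∂P| ≤ ε) →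
      |∫ ω, projForm c J (q' ω) (q' ω) ∂P - ∫ ω, projForm c J (q ω) (q ω) ∂P| ≤ ε →
      ∀ w ∈ G.capacityRegion, (∀ ℓ ∈ G.facetsThrough c b ν, w ∈ G.facet c b ℓ) →
        |∫ ω, inner ℝ (q ω) w ∂P
          - 1 / (2 * ε) * ∫ ω, projForm c J (a ω - (1 - ε) • ν) (a ω - (1 - ε) • ν) ∂P
          - 1 / (2 * ε) * onesForm (((colMatrix c J)ᵀ * colMatrix c J)⁻¹ ⊙ G.covB c J)|
        ≤ β * Real.log (1 / ε) := by
  classical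
  set T := G.facetsThrough c b ν with hT
  set F : Finset (Fin L) := Finset.univ.filter (· ∈ T) with hFdef
  have hF : ∀ ℓ, ℓ ∈ F ↔ ℓ ∈ T := fun ℓ => by simp [hFdef]
  obtain ⟨C, hC, hdrift⟩ := hcb.exists_abs_drift_sub_le hF hJ D
  obtain ⟨B, hB, hSB⟩ := G.exists_norm_service_le
  obtain ⟨W, hW, hCW⟩ := exists_norm_capacityRegion_le hcb
  set Γ := ∑ ℓ : J, ∑ ℓ' : J, |((colMatrix c J)ᵀ * colMatrix c J)⁻¹ ℓ ℓ'| with hΓdef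
  have hΓ : 0 ≤ Γ := Finset.sum_nonneg fun _ _ => Finset.sum_nonneg fun _ _ => abs_nonneg _
  set K := ∑ ℓ ∈ F, (b ℓ + 1) with hK
  have hK0 : 0 ≤ K := Finset.sum_nonneg fun ℓ _ => by linarith [hcb.b_pos ℓ]
  set Y := F.card * (2 * B + |D|) with hYdef
  set β₁ := (K + Y * A) / θ with hβ₁
  set β₂ := (W + Γ * (J.card * W)) * (A / θ) with hβ₂
  refine ⟨(1 + C * (2 * |β₁| + 2 * K + 1)) / 2 + |β₂|, ?_⟩
  intro ε hε hε1 Ω _ P _ M a s u q q' h hq hq' hlin hquad w hw hwF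
  have hb : ∀ ℓ ∈ T, G.meanMaxWeight (c ℓ) = b ℓ := fun ℓ hℓ => by
    rw [hcb.meanMaxWeight_eq hν (mem_normalCone_of_mem (c := c) (P := T) hℓ)]; exact hℓ.2
  have hbJ : ∀ ℓ ∈ J, G.meanMaxWeight (c ℓ) = b ℓ := fun ℓ hℓ => hb ℓ (hJ.prop.1 ℓ hℓ)
  have hlog : 1 ≤ Real.log (1 / ε) := by
    rw [one_div, Real.log_inv]
    have := Real.log_le_log hε hε1
    rw [Real.log_exp] at this
    linarith
  have hε_lt : ε < 1 := hε1.trans_lt (by simp)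
  set p : Vec n → Vec n := coneProj c T with hp
  have hpc : Continuous p := continuous_coneProj
  set lam := (1 - ε) • ν with hlam
  set gap : Ω → ℝ := fun ω => G.totalGap c F (M ω) (s ω) with hgap
  set U : Ω → ℝ := fun ω => ∑ ℓ ∈ F, inner ℝ (c ℓ) (u ω) with hU
  have hgapℓ : ∀ ℓ, Integrable (fun ω => G.maxWeight (c ℓ) (M ω) - inner ℝ (c ℓ) (s ω)) P :=
    fun ℓ => (h.integrable_maxWeight _).sub
      (SwitchStep.integrable_inner _ h.measurable_s ⟨D, h.norm_s_le⟩)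
  have hUℓ : ∀ ℓ, Integrable (fun ω => inner ℝ (c ℓ) (u ω)) P := fun ℓ =>
    SwitchStep.integrable_inner _ h.measurable_u ⟨D, h.norm_u_le⟩
  have hgapi : Integrable gap P := integrable_finsetSum _ fun ℓ _ => hgapℓ ℓ
  have hUi : Integrable U P := integrable_finsetSum _ fun ℓ _ => hUℓ ℓ
  have hgap0 : ∀ᵐ ω ∂P, 0 ≤ gap ω := h.maxWeight.mono fun ω hω => totalGap_nonneg hω.1
  have hU0 : ∀ᵐ ω ∂P, 0 ≤ U ω := h.u_nonneg.mono fun ω hω => Finset.sum_nonneg fun ℓ _ => by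
    rw [PiLp.inner_apply]
    exact Finset.sum_nonneg fun i _ => mul_nonneg (hω i) (hcb.c_nonneg ℓ i)
  have hgapB : ∀ᵐ ω ∂P, gap ω ≤ Y := by
    filter_upwards [h.maxWeight] with ω hω
    rw [hYdef, ← nsmul_eq_mul]
    refine Finset.sum_le_card_nsmul _ _ _ fun ℓ _ => ?_
    obtain ⟨y, hy, hyc⟩ := G.exists_maxWeight_eq (c ℓ) (M ω)
    have e1 := abs_real_inner_le_norm (c ℓ) y
    have e2 := abs_real_inner_le_norm (c ℓ) (s ω)
    rw [hcb.c_norm, one_mul] at e1 e2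
    rw [hyc]
    linarith [(abs_le.1 (e1.trans (hSB _ y hy))).2, (abs_le.1 (e2.trans (hSB _ _ hω.1))).1,
      abs_nonneg D]
  have hUB : ∀ᵐ ω ∂P, U ω ≤ Y := by
    filter_upwards [h.norm_u_le] with ω hω
    rw [hYdef, ← nsmul_eq_mul]
    refine Finset.sum_le_card_nsmul _ _ _ fun ℓ _ => ?_
    have e1 := abs_real_inner_le_norm (c ℓ) (u ω)
    rw [hcb.c_norm, one_mul] at e1
    linarith [(abs_le.1 (e1.trans hω)).2, le_abs_self D]
  have hsum : ∫ ω, gap ω ∂P + ∫ ω, U ω ∂P ≤ K * ε := by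
    simp only [hgap, hU, totalGap]
    rw [integral_finsetSum _ fun ℓ _ => hgapℓ ℓ, integral_finsetSum _ fun ℓ _ => hUℓ ℓ,
      ← Finset.sum_add_distrib, hK, Finset.sum_mul]
    refine Finset.sum_le_sum fun ℓ hℓ => ?_
    rw [h.integral_gap_add_integral_unused, hb ℓ ((hF ℓ).1 hℓ), hlam, real_inner_smul_right,
      ((hF ℓ).1 hℓ).2]
    linarith [(abs_le.1 (hlin ℓ)).2]
  have hgapε : ∫ ω, gap ω ∂P ≤ K * ε := by linarith [integral_nonneg_of_ae hU0]
  have hUε : ∫ ω, U ω ∂P ≤ K * ε := by linarith [integral_nonneg_of_ae hgap0]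
  have hZgi : Integrable (fun ω => ‖q ω - p (q ω)‖ * gap ω) P := by
    obtain ⟨R, hR⟩ :=
      SwitchStep.exists_bound_comp (f := fun x => ‖x - p x‖) (by fun_prop) h.bounded_q
    exact hgapi.bdd_mul (h.integrable_comp_q (f := fun x => ‖x - p x‖) (by fun_prop)).1 hR
  have hZUi : Integrable (fun ω => ‖q' ω - p (q' ω)‖ * U ω) P := by
    obtain ⟨R, hR⟩ :=
      SwitchStep.exists_bound_comp (f := fun x => ‖x - p x‖) (by fun_prop) h.bounded_q'
    exact hUi.bdd_mul (h.integrable_comp_q' (f := fun x => ‖x - p x‖) (by fun_prop)).1 hR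
  have hZg := integral_mul_le_log hθ hε hε1 hgap0 hgapB hgapi hgapε hZgi
    (h.integrable_comp_q (f := fun x => Real.exp (θ * ‖x - p x‖)) (by fun_prop)) hq
  have hZU := integral_mul_le_log hθ hε hε1 hU0 hUB hUi hUε hZUi
    (h.integrable_comp_q' (f := fun x => Real.exp (θ * ‖x - p x‖)) (by fun_prop)) hq'
  -- the mean of the one-slot drift
  have hrem := calc
    |(∫ ω, projForm c J (q' ω) (q' ω) ∂P - ∫ ω, projForm c J (q ω) (q ω) ∂P)
        + 2 * ε * ∫ ω, projForm c J (q ω) ν ∂P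
        - ∫ ω, projForm c J (a ω - lam) (a ω - lam) ∂P
        - onesForm (((colMatrix c J)ᵀ * colMatrix c J)⁻¹ ⊙ G.covB c J)|
      = |∫ ω, (projForm c J (q' ω) (q' ω) - projForm c J (q ω) (q ω)
          + 2 * ε * projForm c J (q ω) ν - projForm c J (a ω - lam) (a ω - lam)
          - G.channelForm c b J (M ω) - 2 * projForm c J (q ω) (a ω - lam)
          - 2 * projForm c J (lam - s ω) (a ω - lam)
          - 2 * G.facetDrift c b T J ν (M ω) (q ω)) ∂P| := by
        rw [h.integral_drift_eq hcb hν hbJ]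
    _ ≤ ∫ ω, C * (‖q ω - p (q ω)‖ * gap ω + gap ω + ε + ‖q' ω - p (q' ω)‖ * U ω + U ω) ∂P := by
        rw [← Real.norm_eq_abs]
        refine norm_integral_le_of_norm_le ?_ ?_
        · fun_prop
        · filter_upwards [h.maxWeight, h.norm_u_le, h.u_nonneg, h.unused, h.evolution]
            with ω h1 h2 h3 h4 h5
          exact hdrift ε hε hε_lt (M ω) (a ω) (s ω) (u ω) (q ω) (q' ω) h1 h2 h3 h4 h5
    _ = C * (∫ ω, ‖q ω - p (q ω)‖ * gap ω ∂P + ∫ ω, gap ω ∂P + ε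
          + ∫ ω, ‖q' ω - p (q' ω)‖ * U ω ∂P + ∫ ω, U ω ∂P) := by
        rw [integral_const_mul, integral_add (by fun_prop) (by fun_prop),
          integral_add (by fun_prop) (by fun_prop), integral_add (by fun_prop) (by fun_prop),
          integral_add (by fun_prop) (by fun_prop)]
        simp
    _ ≤ C * ((2 * |β₁| + 2 * K + 1) * (ε * Real.log (1 / ε))) := by
        have hεl : ε ≤ ε * Real.log (1 / ε) := le_mul_of_one_le_right hε.le hlog
        have e1 := mul_le_mul_of_nonneg_left hεl hK0
        have e2 := mul_le_mul_of_nonneg_right (le_abs_self β₁) (hε.le.trans hεl)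
        refine mul_le_mul_of_nonneg_left ?_ hC
        linarith
  -- the queue lengths in the direction `w` agree with the form up to the distance to the cone
  have hdist := h.abs_integral_inner_sub_le hcb hν hJ hθ hq hCW hwF hw
  set x := ∫ ω, projForm c J (q ω) ν ∂P
  set EA := ∫ ω, projForm c J (a ω - lam) (a ω - lam) ∂P
  set EB := onesForm (((colMatrix c J)ᵀ * colMatrix c J)⁻¹ ⊙ G.covB c J)
  set l := Real.log (1 / ε)
  have hx : |x - 1 / (2 * ε) * EA - 1 / (2 * ε) * EB|
      ≤ (1 + C * (2 * |β₁| + 2 * K + 1)) / 2 * l := by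
    have e1 : x - 1 / (2 * ε) * EA - 1 / (2 * ε) * EB = (2 * ε * x - EA - EB) / (2 * ε) := by
      field_simp
    rw [e1, abs_div, abs_of_pos (by positivity : 0 < 2 * ε), div_le_iff₀ (by positivity)]
    have e2 := abs_le.1 hrem
    have e3 := abs_le.1 hquad
    have e4 : ε ≤ ε * l := le_mul_of_one_le_right hε.le hlog
    rw [abs_le]
    constructor <;> linarith [e2.1, e2.2, e3.1, e3.2]
  have e0 : |β₂| ≤ |β₂| * l := le_mul_of_one_le_right (abs_nonneg _) hlog
  have e1 := abs_le.1 (hdist.trans (le_abs_self β₂))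
  have e2 := abs_le.1 hx
  rw [add_mul, abs_le]
  constructor <;> linarith [e1.1, e1.2, e2.1, e2.2]

end GeneralizedSwitch

/-! ### Convergence of moments -/

section Moments

variable {E : Type*} [TopologicalSpace E] [MeasurableSpace E] [BorelSpace E]
  [HasOuterApproxClosed E]

/-- A bound on the means of a non-negative continuous function passes to the weak limit. -/
lemma integrable_and_integral_le_of_tendsto {κ : ℕ → ProbabilityMeasure E}
    {κ' : ProbabilityMeasure E} (hκ : Tendsto κ atTop (𝓝 κ')) {V : E → ℝ} (hV : Continuous V)
    (hV0 : ∀ x, 0 ≤ V x) {C : ℝ} (hi : ∀ j, Integrable V (κ j : Measure E))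
    (hC : ∀ j, ∫ x, V x ∂(κ j : Measure E) ≤ C) :
    Integrable V (κ' : Measure E) ∧ ∫ x, V x ∂(κ' : Measure E) ≤ C := by
  have hC0 : 0 ≤ C := (integral_nonneg hV0).trans (hC 0)
  have h1 := lintegral_le_liminf_lintegral_of_forall_isOpen_measure_le_liminf_measure hV hV0
    fun G hG => ProbabilityMeasure.le_liminf_measure_open_of_tendsto hκ hG
  have h2 : ∫⁻ x, ENNReal.ofReal (V x) ∂(κ' : Measure E) ≤ ENNReal.ofReal C := by
    refine h1.trans (liminf_le_of_frequently_le' (Eventually.of_forall fun j => ?_).frequently)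
    rw [← ofReal_integral_eq_lintegral_ofReal (hi j) (Eventually.of_forall hV0)]
    exact ENNReal.ofReal_le_ofReal (hC j)
  have h3 : Integrable V (κ' : Measure E) := by
    refine ⟨hV.aestronglyMeasurable, ?_⟩
    rw [hasFiniteIntegral_iff_ofReal (Eventually.of_forall hV0)]
    exact h2.trans_lt ENNReal.ofReal_lt_top
  refine ⟨h3, ?_⟩
  rw [← ofReal_integral_eq_lintegral_ofReal h3 (Eventually.of_forall hV0)] at h2
  exact (ENNReal.ofReal_le_ofReal_iff hC0).1 h2

/-- If `f` is continuous and `f ^ 2` is dominated by a function with bounded means along a weakly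
convergent sequence, then the means of `f` converge. -/
lemma tendsto_integral_of_sq_le {κ : ℕ → ProbabilityMeasure E}
    {κ' : ProbabilityMeasure E} (hκ : Tendsto κ atTop (𝓝 κ')) {V : E → ℝ} (hV : Continuous V)
    {C : ℝ} (hi : ∀ j, Integrable V (κ j : Measure E))
    (hC : ∀ j, ∫ x, V x ∂(κ j : Measure E) ≤ C) {f : E → ℝ} (hf : Continuous f)
    (hfV : ∀ x, f x ^ 2 ≤ V x) :
    Integrable f (κ' : Measure E) ∧
      Tendsto (fun j => ∫ x, f x ∂(κ j : Measure E)) atTop (𝓝 (∫ x, f x ∂(κ' : Measure E))) := by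
  have hV0 : ∀ x, 0 ≤ V x := fun x => (sq_nonneg _).trans (hfV x)
  obtain ⟨hi', hC'⟩ := integrable_and_integral_le_of_tendsto hκ hV hV0 hi hC
  have hC0 : 0 ≤ C := (integral_nonneg hV0).trans hC'
  have hfi : ∀ {κ : ProbabilityMeasure E}, Integrable V (κ : Measure E) →
      Integrable f (κ : Measure E) := fun {κ} h => by
    refine ((integrable_const (1 : ℝ)).add h).mono' hf.aestronglyMeasurable
      (Eventually.of_forall fun x => ?_)
    rw [Real.norm_eq_abs, Pi.add_apply]
    nlinarith [hfV x, sq_abs (f x), sq_nonneg (|f x| - 1)]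
  refine ⟨hfi hi', ?_⟩
  rw [Metric.tendsto_atTop]
  intro ε hε
  set N := 4 * (C + 1) / ε with hN
  have hN0 : 0 < N := by positivity
  -- `f` clipped at level `N`
  set g : E → ℝ := fun x => max (-N) (min (f x) N) with hg
  have hgc : Continuous g := by fun_prop
  have hgN : ∀ x, |g x| ≤ N := fun x =>
    abs_le.2 ⟨le_max_left _ _, max_le (by linarith) (min_le_right _ _)⟩
  have hfg : ∀ x, |f x - g x| ≤ V x / N := fun x => by
    rw [le_div_iff₀ hN0]
    refine le_trans ?_ (hfV x)
    simp only [hg]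
    rcases le_total (f x) N with h | h
    · rw [min_eq_left h]
      rcases le_total (-N) (f x) with h' | h'
      · rw [max_eq_right h']; simp; positivity
      · rw [max_eq_left h', abs_of_nonpos (by linarith)]; nlinarith
    · rw [min_eq_right h, max_eq_right (by linarith), abs_of_nonneg (by linarith)]; nlinarith
  have hgi : ∀ κ : ProbabilityMeasure E, Integrable g (κ : Measure E) := fun κ =>
    Integrable.of_bound hgc.aestronglyMeasurable N (Eventually.of_forall hgN)
  have hclip : ∀ {κ : ProbabilityMeasure E}, Integrable V (κ : Measure E) →
      ∫ x, V x ∂(κ : Measure E) ≤ C →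
      |∫ x, f x ∂(κ : Measure E) - ∫ x, g x ∂(κ : Measure E)| ≤ ε / 4 := fun {κ} h hle => by
    rw [← integral_sub (hfi h) (hgi κ)]
    refine abs_integral_le_integral_abs.trans ?_
    calc ∫ x, |f x - g x| ∂(κ : Measure E) ≤ ∫ x, V x / N ∂(κ : Measure E) :=
          integral_mono ((hfi h).sub (hgi κ)).abs (h.div_const _) hfg
      _ = (∫ x, V x ∂(κ : Measure E)) / N := integral_div _ _
      _ ≤ (C + 1) / N := by gcongr; linarith
      _ = ε / 4 := by rw [hN]; field_simp
  have hgt := (ProbabilityMeasure.tendsto_iff_forall_integral_tendsto.1 hκ)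
    (BoundedContinuousFunction.ofNormedAddCommGroup g hgc N hgN)
  obtain ⟨j₀, hj₀⟩ := Metric.tendsto_atTop.1 hgt (ε / 4) (by positivity)
  refine ⟨j₀, fun j hj => ?_⟩
  have h1 := hj₀ j hj
  rw [Real.dist_eq] at h1 ⊢
  simp only [BoundedContinuousFunction.coe_ofNormedAddCommGroup] at h1
  have h2 := abs_le.1 (hclip (hi j) (hC j))
  have h3 := abs_le.1 (hclip hi' hC')
  have h4 := abs_lt.1 h1
  rw [abs_lt]
  constructor <;> linarith [h2.1, h2.2, h3.1, h3.2, h4.1, h4.2]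

end Moments

/-! ### Conditioning on an event of the past -/

section Conditioning

variable {Ω : Type*} [MeasurableSpace Ω] {μ : Measure Ω}

lemma ae_cond {p : Ω → Prop} (A : Set Ω) (h : ∀ᵐ ω ∂μ, p ω) : ∀ᵐ ω ∂μ[|A], p ω :=
  cond_absolutelyContinuous.ae_le h

variable [IsProbabilityMeasure μ]

lemma indepFun_cond {α β : Type*} [MeasurableSpace α] [MeasurableSpace β] {X : Ω → α} {Y : Ω → β}
    (h : IndepFun X Y μ) (hX : Measurable X) {S : Set α} (hS : MeasurableSet S)
    (h0 : μ (X ⁻¹' S) ≠ 0) (hY : Measurable Y) :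
    IndepFun X Y μ[|X ⁻¹' S] ∧ μ[|X ⁻¹' S].map Y = μ.map Y := by
  have hA : MeasurableSet (X ⁻¹' S) := hX hS
  have h1 : ∀ t, MeasurableSet t → μ[|X ⁻¹' S] (Y ⁻¹' t) = μ (Y ⁻¹' t) := fun t ht => by
    rw [cond_apply hA, h.measure_inter_preimage_eq_mul _ _ hS ht, ← mul_assoc,
      ENNReal.inv_mul_cancel h0 (measure_ne_top _ _), one_mul]
  refine ⟨?_, Measure.ext fun t ht => ?_⟩
  · rw [indepFun_iff_measure_inter_preimage_eq_mul]
    intro s t hs ht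
    rw [h1 t ht, cond_apply hA, cond_apply hA, ← Set.inter_assoc, ← Set.preimage_inter,
      h.measure_inter_preimage_eq_mul _ _ (hS.inter hs) ht, mul_assoc]
  · rw [Measure.map_apply hY ht, Measure.map_apply hY ht, h1 t ht]

lemma abs_integral_cond_sub_le {A : Set Ω} (hA : MeasurableSet A) (h0 : μ A ≠ 0) {f : Ω → ℝ}
    (hf : Measurable f) {N : ℝ} (hN : ∀ ω, |f ω| ≤ N) :
    |∫ ω, f ω ∂μ[|A] - ∫ ω, f ω ∂μ| ≤ 2 * N * (1 - μ.real A) := by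
  have hi : Integrable f μ :=
    Integrable.of_bound hf.aestronglyMeasurable N (Eventually.of_forall hN)
  have := cond_isProbabilityMeasure h0
  have hr : 0 < μ.real A := ENNReal.toReal_pos h0 (measure_ne_top _ _)
  have hr1 : μ.real A ≤ 1 := measureReal_le_one
  have h1 : ∫ ω, f ω ∂μ[|A] = (μ.real A)⁻¹ * ∫ ω in A, f ω ∂μ := by
    rw [ProbabilityTheory.cond, integral_smul_measure, ENNReal.toReal_inv]; rfl
  have h2 : |∫ ω, f ω ∂μ[|A]| ≤ N := by
    refine abs_integral_le_integral_abs.trans ?_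
    have i : Integrable f μ[|A] :=
      Integrable.of_bound hf.aestronglyMeasurable N (Eventually.of_forall hN)
    calc ∫ ω, |f ω| ∂μ[|A] ≤ ∫ ω, N ∂μ[|A] := integral_mono i.abs (integrable_const _) hN
      _ = N := by simp
  have h3 : |∫ ω in Aᶜ, f ω ∂μ| ≤ N * (1 - μ.real A) := by
    have := norm_setIntegral_le_of_norm_le_const (f := f) (C := N) (μ := μ) (s := Aᶜ)
      (measure_lt_top _ _) fun x _ => hN x
    rwa [probReal_compl_eq_one_sub hA] at this
  have h4 : ∫ ω, f ω ∂μ = μ.real A * ∫ ω, f ω ∂μ[|A] + ∫ ω in Aᶜ, f ω ∂μ := by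
    rw [h1, ← integral_add_compl hA hi]
    field_simp
  have h5 : ∫ ω, f ω ∂μ[|A] - ∫ ω, f ω ∂μ
      = (1 - μ.real A) * ∫ ω, f ω ∂μ[|A] - ∫ ω in Aᶜ, f ω ∂μ := by rw [h4]; ring
  rw [h5]
  refine (abs_sub _ _).trans ?_
  rw [abs_mul, abs_of_nonneg (by linarith : 0 ≤ 1 - μ.real A)]
  have := mul_le_mul_of_nonneg_left h2 (by linarith : 0 ≤ 1 - μ.real A)
  linarith

end Conditioning

lemma eventually_le_of_contraction {x : ℕ → ℝ} {r e : ℝ} (hr : 0 ≤ r) (hr1 : r < 1)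
    (h : ∀ k, x (k + 1) ≤ r * x k + e) : ∀ᶠ k in atTop, x k ≤ e / (1 - r) + 1 := by
  have h1 : 0 < 1 - r := by linarith
  have hk : ∀ k, x k ≤ r ^ k * (x 0 - e / (1 - r)) + e / (1 - r) := fun k => by
    induction k with
    | zero => simp
    | succ k ih =>
      have h2 := mul_le_mul_of_nonneg_left ih hr
      have h3 : r * (e / (1 - r)) + e = e / (1 - r) := by field_simp; ring
      calc x (k + 1) ≤ r * x k + e := h k
        _ ≤ r * (r ^ k * (x 0 - e / (1 - r)) + e / (1 - r)) + e := by linarith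
        _ = r ^ (k + 1) * (x 0 - e / (1 - r)) + (r * (e / (1 - r)) + e) := by ring
        _ = _ := by rw [h3]
  have ht : Tendsto (fun k => r ^ k * (x 0 - e / (1 - r))) atTop (𝓝 0) := by
    simpa using (tendsto_pow_atTop_nhds_zero_of_lt_one hr hr1).mul_const (x 0 - e / (1 - r))
  filter_upwards [ht.eventually_le_const one_pos] with k h2
  linarith [hk k]

/-! ### From the dynamics to single slots -/

namespace GeneralizedSwitch

variable {n L : ℕ} {𝓜 : Type*} [Fintype 𝓜] [MeasurableSpace 𝓜] [MeasurableSingletonClass 𝓜]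

/-- Given that the initial queue lengths are bounded, every slot of the dynamics is a `SwitchStep`,
with a bound `D` that depends on the switch and on `Amax` only. Conditioning on this event of the
past changes neither the independence of channel states and arrivals from the past nor their
laws. -/
lemma exists_switchStep_cond (G : GeneralizedSwitch n 𝓜) (Amax : ℝ) :
    ∃ D : ℝ, 0 < D ∧ ∀ (lam : Vec n) (Ω : Type*) [MeasurableSpace Ω] (μ : Measure Ω)
      [IsProbabilityMeasure μ] (M : ℕ → Ω → 𝓜) (a s u q : ℕ → Ω → Vec n),
      G.IsMaxWeightDynamics μ M a s u q → (∀ᵐ ω ∂μ, ∀ i, a 1 ω i ≤ Amax) →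
      (∀ i, ∫ ω, a 1 ω i ∂μ = lam i) → (∀ᵐ ω ∂μ, ‖a 1 ω‖ ≤ D) ∧
      ∀ R : ℝ, μ {ω | ‖q 0 ω‖ ≤ R} ≠ 0 → ∀ k,
        SwitchStep G μ[|{ω | ‖q 0 ω‖ ≤ R}] D lam (M k) (a k) (s k) (u k) (q k) (q (k + 1)) ∧
        μ[|{ω | ‖q 0 ω‖ ≤ R}].map (a k) = μ.map (a 1) := by
  obtain ⟨B, hB, hSB⟩ := G.exists_norm_service_le
  set D := (n : ℝ) * (|Amax| + B) + B with hD
  refine ⟨D, by positivity, fun lam Ω _ μ _ M a s u q h hA hmean => ?_⟩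
  have hn : ∀ {x : Vec n} {r : ℝ}, r ≤ |Amax| + B → (∀ i, 0 ≤ x i) → (∀ i, x i ≤ r) → ‖x‖ ≤ D := by
    intro x r hr h0 hle
    have h1 : ∑ i, |x i| ≤ n * (|Amax| + B) := by
      calc ∑ i, |x i| ≤ ∑ _i : Fin n, (|Amax| + B) := Finset.sum_le_sum fun i _ => by
            rw [abs_of_nonneg (h0 i)]; exact (hle i).trans hr
        _ = _ := by rw [Finset.sum_const, Finset.card_univ, Fintype.card_fin, nsmul_eq_mul]
    linarith [norm_le_sum_abs x]
  have hA1 : |Amax| ≤ |Amax| + B := by linarith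
  have ha : ∀ᵐ ω ∂μ, ‖a 1 ω‖ ≤ D := by
    filter_upwards [hA, h.a_nonneg 1] with ω h1 h2
    exact hn hA1 h2 fun i => (h1 i).trans (le_abs_self _)
  have hak : ∀ k, ∀ᵐ ω ∂μ, ‖a k ω‖ ≤ D := fun k =>
    (h.ident_a k).symm.ae_snd (measurableSet_le measurable_norm measurable_const) ha
  have hs : ∀ k, ∀ᵐ ω ∂μ, ‖s k ω‖ ≤ B := fun k =>
    (h.maxWeight k).mono fun ω hω => hSB _ _ hω.1
  have hu : ∀ k, ∀ᵐ ω ∂μ, ‖u k ω‖ ≤ D := fun k => by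
    filter_upwards [h.u_nonneg k, h.unused k, h.evolution k, h.a_nonneg k, h.q_nonneg k, hs k]
      with ω h1 h2 h3 h4 h5 h6
    refine hn (le_add_of_nonneg_left (abs_nonneg _)) h1 fun i => ?_
    have hsi := (abs_le.1 ((PiLp.norm_apply_le (s k ω) i).trans h6)).2
    rcases mul_eq_zero.1 (h2 i) with h0 | h0
    · -- an empty queue wastes at most the offered service
      have := congrArg (fun x : Vec n => x i) h3
      simp only [PiLp.add_apply, PiLp.sub_apply, h0] at this
      linarith [h4 i, h5 i]
    · rw [h0]; exact hB.le
  refine ⟨ha, fun R hR k => ?_⟩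
  have := cond_isProbabilityMeasure hR
  set A : Set Ω := {ω | ‖q 0 ω‖ ≤ R} with hAdef
  have hAm : MeasurableSet A := measurableSet_le (h.measurable_q 0).norm measurable_const
  have hqb : ∀ k, ∃ R', ∀ᵐ ω ∂μ[|A], ‖q k ω‖ ≤ R' := fun k => by
    induction k with
    | zero => exact ⟨R, ae_cond_mem hAm⟩
    | succ k ih =>
      obtain ⟨R', hR'⟩ := ih
      refine ⟨R' + D + B + D, ?_⟩
      filter_upwards [hR', ae_cond A (hak k), ae_cond A (hs k), ae_cond A (hu k),
        ae_cond A (h.evolution k)] with ω h1 h2 h3 h4 h5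
      rw [h5]
      have e1 := norm_add_le (q k ω + a k ω - s k ω) (u k ω)
      have e2 := norm_sub_le (q k ω + a k ω) (s k ω)
      have e3 := norm_add_le (q k ω) (a k ω)
      linarith
  -- the history before slot `k`, without and with the channel state and the schedule of slot `k`
  have hm1 : Measurable fun ω => ((fun j : Fin (k + 1) => q j ω),
      fun j : Fin k => (M j ω, a j ω, s j ω)) :=
    (measurable_pi_lambda _ fun j : Fin (k + 1) => h.measurable_q j).prodMk
      (measurable_pi_lambda _ fun j : Fin k =>
        (h.measurable_M j).prodMk ((h.measurable_a j).prodMk (h.measurable_s j)))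
  have hm2 := hm1.prodMk ((h.measurable_M k).prodMk (h.measurable_s k))
  have hM := indepFun_cond (h.indep_M k) hm1
    (S := {x | ‖x.1 0‖ ≤ R}) (measurableSet_le (by fun_prop) measurable_const) hR
    (h.measurable_M k)
  have ha' := indepFun_cond (h.indep_a k) hm2
    (S := {x | ‖x.1.1 0‖ ≤ R}) (measurableSet_le (by fun_prop) measurable_const) hR
    (h.measurable_a k)
  have hlaw : μ[|A].map (a k) = μ.map (a 1) := ha'.2.trans (h.ident_a k).map_eq
  refine ⟨?_, hlaw⟩
  exact
    { measurable_M := h.measurable_M k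
      measurable_a := h.measurable_a k
      measurable_s := h.measurable_s k
      measurable_u := h.measurable_u k
      measurable_q := h.measurable_q k
      measurable_q' := h.measurable_q (k + 1)
      map_M := by
        refine hM.2.trans (Measure.ext_of_singleton fun m => ?_)
        rw [Measure.map_apply (h.measurable_M k) (measurableSet_singleton m), h.law_M k m,
          PMF.toMeasure_apply_singleton _ _ (measurableSet_singleton m)]
      indep_M := hM.1.comp (ψ := id)
        (φ := fun x : (Fin (k + 1) → Vec n) × (Fin k → 𝓜 × Vec n × Vec n) => x.1 (Fin.last k))
        (by fun_prop) measurable_id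
      indep_a := ha'.1.comp (ψ := id)
        (φ := fun x : ((Fin (k + 1) → Vec n) × (Fin k → 𝓜 × Vec n × Vec n)) × 𝓜 × Vec n =>
          (x.1.1 (Fin.last k), x.2.2)) (by fun_prop) measurable_id
      mean_a := fun i => by
        have hc : Measurable fun x : Vec n => x i := by fun_prop
        rw [← hmean i, ← integral_map (f := fun x : Vec n => x i) (h.measurable_a k).aemeasurable
          hc.aestronglyMeasurable, hlaw, integral_map (h.measurable_a 1).aemeasurable
          hc.aestronglyMeasurable]
      maxWeight := ae_cond A (h.maxWeight k)
      q_nonneg := ae_cond A (h.q_nonneg k)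
      u_nonneg := ae_cond A (h.u_nonneg k)
      evolution := ae_cond A (h.evolution k)
      unused := ae_cond A (h.unused k)
      norm_a_le := ae_cond A (hak k)
      norm_s_le := ae_cond A ((hs k).mono fun ω hω => hω.trans (by
        rw [hD]; linarith [(by positivity : 0 ≤ (n : ℝ) * (|Amax| + B))]))
      norm_u_le := ae_cond A (hu k)
      bounded_q := hqb k }

/-- Bounded exponential moments of the distance of the queue lengths to the range of `p` at late
times, under a drift towards the range of `p` at rate `δ`. The bound depends on `δ` and `D` only. -/
lemma eventually_integral_exp_le {G : GeneralizedSwitch n 𝓜} {Ω : Type*} [MeasurableSpace Ω]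
    {P : Measure Ω} [IsProbabilityMeasure P] {D : ℝ} {lam : Vec n} {M : ℕ → Ω → 𝓜}
    {a s u q : ℕ → Ω → Vec n}
    (h : ∀ k, SwitchStep G P D lam (M k) (a k) (s k) (u k) (q k) (q (k + 1)))
    {δ : ℝ} (hδ : 0 < δ) (hδD : δ ≤ D) {p : Vec n → Vec n} (hp : Continuous p)
    (hp0 : ∀ x i, 0 ≤ p x i) (hmin : ∀ x y, ‖x - p x‖ ≤ ‖x - p y‖)
    (hdrift : ∀ x : Vec n, (∀ i, 0 ≤ x i) → inner ℝ (x - p x) lam - G.meanMaxWeight x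
      + G.meanMaxWeight (p x) ≤ -δ * ‖x - p x‖) :
    ∀ᶠ k in atTop, ∫ ω, Real.exp (δ / (36 * D ^ 2) * ‖q k ω - p (q k ω)‖) ∂P ≤
      2 * Real.exp (δ / (36 * D ^ 2) * (16 * D ^ 2 / δ + 3 * D)) / (δ / (36 * D ^ 2) * δ / 4)
        + 1 := by
  have hD : 0 < D := hδ.trans_le hδD
  have hθδ : δ / (36 * D ^ 2) * δ ≤ 1 := by
    rw [div_mul_eq_mul_div, div_le_one (by positivity)]
    nlinarith
  have := eventually_le_of_contraction
    (x := fun k => ∫ ω, Real.exp (δ / (36 * D ^ 2) * ‖q k ω - p (q k ω)‖) ∂P)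
    (r := 1 - δ / (36 * D ^ 2) * δ / 4)
    (by linarith) (by linarith [(by positivity : 0 < δ / (36 * D ^ 2) * δ / 4)])
    fun k => (h k).integral_exp_le hδ hδD hp hp0 hmin hdrift
  simpa only [sub_sub_cancel] using this

end GeneralizedSwitch

/-! ### Passage to the steady state -/

section Limit

variable {n : ℕ} {Ω : Type*} [MeasurableSpace Ω] {μ : Measure Ω} [IsProbabilityMeasure μ]
  {Ω' : Type*} [MeasurableSpace Ω'] {μ' : Measure Ω'} [IsProbabilityMeasure μ']
  {q : ℕ → Ω → Vec n} {qbar : Ω' → Vec n}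

/-- Let `A j` be events whose probability tends to `1`, and `k j → ∞`. If the exponential moments of
`q (k j)` given `A j` are bounded, then the means of `f (q (k j))` given `A j` converge to the mean
of `f` in the limit in distribution of `q`, for continuous `f` of moderate growth. -/
lemma tendsto_integral_cond (hq : ∀ k, Measurable (q k))
    (hconv : TendstoInDistribution q atTop qbar (fun _ => μ) μ') {A : ℕ → Set Ω}
    (hA : ∀ j, MeasurableSet (A j)) (hA0 : ∀ j, μ (A j) ≠ 0)
    (hA1 : Tendsto (fun j => μ.real (A j)) atTop (𝓝 1)) {k : ℕ → ℕ} (hk : Tendsto k atTop atTop)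
    {θ C : ℝ} (hi : ∀ j, Integrable (fun ω => Real.exp (θ * ‖q (k j) ω‖)) μ[|A j])
    (hC : ∀ j, ∫ ω, Real.exp (θ * ‖q (k j) ω‖) ∂μ[|A j] ≤ C) {f : Vec n → ℝ} (hf : Continuous f)
    {K : ℝ} (hK : 0 ≤ K) (hfK : ∀ x, f x ^ 2 ≤ K * Real.exp (θ * ‖x‖)) :
    Integrable (fun ω => f (qbar ω)) μ' ∧
      Tendsto (fun j => ∫ ω, f (q (k j) ω) ∂μ[|A j]) atTop (𝓝 (∫ ω, f (qbar ω) ∂μ')) := by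
  have hP : ∀ j, IsProbabilityMeasure μ[|A j] := fun j => cond_isProbabilityMeasure (hA0 j)
  have hqbar := hconv.aemeasurable_limit
  set κ : ℕ → ProbabilityMeasure (Vec n) := fun j =>
    ⟨μ[|A j].map (q (k j)), Measure.isProbabilityMeasure_map (hq _).aemeasurable⟩ with hκdef
  set κ' : ProbabilityMeasure (Vec n) := ⟨μ'.map qbar, Measure.isProbabilityMeasure_map hqbar⟩
    with hκ'def
  have hκi : ∀ j {g : Vec n → ℝ}, Continuous g →
      ∫ x, g x ∂(κ j : Measure (Vec n)) = ∫ ω, g (q (k j) ω) ∂μ[|A j] := fun j g hg =>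
    integral_map (hq _).aemeasurable hg.aestronglyMeasurable
  have hκ'i : ∀ {g : Vec n → ℝ}, Continuous g →
      ∫ x, g x ∂(κ' : Measure (Vec n)) = ∫ ω, g (qbar ω) ∂μ' := fun {g} hg =>
    integral_map hqbar hg.aestronglyMeasurable
  have hκ : Tendsto κ atTop (𝓝 κ') := by
    rw [ProbabilityMeasure.tendsto_iff_forall_integral_tendsto]
    intro g
    rw [hκ'i g.continuous]
    simp only [hκi _ g.continuous]
    have h1 := (ProbabilityMeasure.tendsto_iff_forall_integral_tendsto.1 hconv.tendsto g).comp hk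
    have h2 : Tendsto (fun j => ∫ ω, g (q (k j) ω) ∂μ) atTop (𝓝 (∫ ω, g (qbar ω) ∂μ')) := by
      convert! h1 using 2 with j
      · exact (integral_map (hq _).aemeasurable g.continuous.aestronglyMeasurable).symm
      · exact (hκ'i g.continuous).symm
    have h3 : Tendsto (fun j => ∫ ω, g (q (k j) ω) ∂μ[|A j] - ∫ ω, g (q (k j) ω) ∂μ) atTop
        (𝓝 0) := by
      have h4 : Tendsto (fun j => 2 * ‖g‖ * (1 - μ.real (A j))) atTop (𝓝 0) := by
        simpa using (hA1.const_sub 1).const_mul (2 * ‖g‖)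
      exact squeeze_zero_norm (fun j => abs_integral_cond_sub_le (hA j) (hA0 j)
        (g.continuous.measurable.comp (hq _)) fun ω => g.norm_coe_le_norm _) h4
    simpa using h3.add h2
  have hV : Continuous fun x : Vec n => K * Real.exp (θ * ‖x‖) := by fun_prop
  have hE : Continuous fun x : Vec n => Real.exp (θ * ‖x‖) := by fun_prop
  have h1 := tendsto_integral_of_sq_le hκ hV (C := K * C) (fun j => ?_) (fun j => ?_) hf hfK
  · rw [hκ'i hf] at h1
    simp only [hκi _ hf] at h1
    exact ⟨(integrable_map_measure hf.aestronglyMeasurable hqbar).1 h1.1, h1.2⟩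
  · exact
      ((integrable_map_measure hE.aestronglyMeasurable (hq _).aemeasurable).2 (hi j)).const_mul K
  · rw [hκi j hV, integral_const_mul]
    exact mul_le_mul_of_nonneg_left (hC j) hK

end Limit

lemma pow_le_mul_exp {θ r : ℝ} (hθ : 0 < θ) (hr : 0 ≤ r) (m : ℕ) :
    r ^ m ≤ (m.factorial : ℝ) / θ ^ m * Real.exp (θ * r) := by
  have h := Real.pow_div_factorial_le_exp (θ * r) (by positivity) m
  rw [div_le_iff₀ (by positivity), mul_pow] at h
  rw [div_mul_eq_mul_div, le_div_iff₀ (by positivity)]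
  linarith

namespace GeneralizedSwitch

lemma meanMaxWeight_zero {n : ℕ} {𝓜 : Type*} [Fintype 𝓜]
    (G : GeneralizedSwitch n 𝓜) : G.meanMaxWeight 0 = 0 := by
  obtain ⟨x, -, hx⟩ := G.exists_inner_eq_meanMaxWeight 0
  rw [← hx, inner_zero_left]

end GeneralizedSwitch

theorem theorem1 {n L : ℕ} {𝓜 : Type*} [Fintype 𝓜] [MeasurableSpace 𝓜]
    [MeasurableSingletonClass 𝓜] (G : GeneralizedSwitch n 𝓜)
    (c : Fin L → Vec n) (b : Fin L → ℝ) (hcb : G.IsHalfspaceRep c b)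
    (ν : Vec n) (hν : ν ∈ frontier G.capacityRegion)
    (hpos : ∀ ℓ ∈ G.facetsThrough c b ν, ∀ i, 0 < c ℓ i → 0 < ν i)
    (Pt : Finset (Fin L))
    (hPt : Maximal (fun J : Finset (Fin L) =>
      (∀ ℓ ∈ J, ℓ ∈ G.facetsThrough c b ν) ∧ LinearIndependent ℝ fun ℓ : J => c ℓ) Pt)
    (Amax : ℝ) :
    ∃ ε₀ ∈ Set.Ioo (0 : ℝ) 1, ∃ β : ℝ, ∀ ε : ℝ, 0 < ε → ε < ε₀ →
      ∀ (Ω : Type*) [MeasurableSpace Ω] (μ : Measure Ω) [IsProbabilityMeasure μ]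
        (M : ℕ → Ω → 𝓜) (a s u q : ℕ → Ω → Vec n),
        G.IsMaxWeightDynamics μ M a s u q →
        (∀ᵐ ω ∂μ, ∀ i, a 1 ω i ≤ Amax) →
        (∀ i, ∫ ω, a 1 ω i ∂μ = (1 - ε) * ν i) →
      ∀ (Ω' : Type*) [MeasurableSpace Ω'] (μ' : Measure Ω') [IsProbabilityMeasure μ']
        (qbar : Ω' → Vec n), TendstoInDistribution q atTop qbar (fun _ => μ) μ' →
      ∀ w ∈ G.capacityRegion, (∀ ℓ ∈ G.facetsThrough c b ν, w ∈ G.facet c b ℓ) →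
        Integrable (fun ω => inner ℝ (qbar ω) w) μ' ∧
        |∫ ω, inner ℝ (qbar ω) w ∂μ'
            - 1 / (2 * ε) * onesForm (projMatrix c Pt ⊙ covMatrix μ (a 1))
            - 1 / (2 * ε) * onesForm
                (((colMatrix c Pt)ᵀ * colMatrix c Pt)⁻¹ ⊙ G.covB c Pt)|
          ≤ β * Real.log (1 / ε) := by
  have hνC : ν ∈ G.capacityRegion := hcb.isClosed.frontier_subset hν
  set T := G.facetsThrough c b ν with hT
  obtain ⟨D, hD, hstep⟩ := G.exists_switchStep_cond Amax
  obtain ⟨δ₁, hδ₁, hdrift₁⟩ := hcb.exists_drift_normalCone hνC hpos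
  obtain ⟨δ₂, hδ₂, hdrift₂⟩ := hcb.exists_drift_zero hνC
  set δ := min δ₁ D with hδdef
  have hδ : 0 < δ := lt_min hδ₁ hD
  have hδD : δ ≤ D := min_le_right _ _
  set θ := δ / (36 * D ^ 2) with hθdef
  have hθ : 0 < θ := by positivity
  set A := 2 * Real.exp (θ * (16 * D ^ 2 / δ + 3 * D)) / (θ * δ / 4) + 1 with hAdef
  obtain ⟨β, hβ⟩ := hcb.exists_heavyTraffic_bound hνC hPt D A hθ
  refine ⟨min (Real.exp (-1)) δ₁,
    ⟨lt_min (Real.exp_pos _) hδ₁, (min_le_left _ _).trans_lt (by simp)⟩,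
    β, ?_⟩
  intro ε hε hε₀ Ω _ μ _ M a s u q hdyn hA hmean Ω' _ μ' _ qbar hconv w hw hwF
  have hε1 : ε < Real.exp (-1) := hε₀.trans_le (min_le_left _ _)
  have hεδ : ε < δ₁ := hε₀.trans_le (min_le_right _ _)
  have hε_lt : ε < 1 := hε1.trans (by simp)
  have hmean' : ∀ i, ∫ ω, a 1 ω i ∂μ = ((1 - ε) • ν) i := fun i => hmean i
  obtain ⟨ha1, hstepμ⟩ := hstep ((1 - ε) • ν) Ω μ M a s u q hdyn hA hmean'
  -- the events that the initial queue lengths are bounded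
  obtain ⟨A₀, hA₀m, hA₀0, hA₀1, hA₀step⟩ : ∃ A₀ : ℕ → Set Ω, (∀ j, MeasurableSet (A₀ j)) ∧
      (∀ j, μ (A₀ j) ≠ 0) ∧ Tendsto (fun j => μ.real (A₀ j)) atTop (𝓝 1) ∧
      ∀ j k, G.SwitchStep μ[|A₀ j] D ((1 - ε) • ν) (M k) (a k) (s k) (u k) (q k) (q (k + 1)) ∧
        μ[|A₀ j].map (a k) = μ.map (a 1) := by
    have hmono : Monotone fun j : ℕ => {ω | ‖q 0 ω‖ ≤ (j : ℝ)} :=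
      fun i j hij ω (hω : ‖q 0 ω‖ ≤ i) =>
        show ‖q 0 ω‖ ≤ (j : ℝ) from hω.trans (Nat.cast_le.2 hij)
    have h1 := tendsto_measure_iUnion_atTop (μ := μ) hmono
    have h2 : ⋃ j : ℕ, {ω | ‖q 0 ω‖ ≤ j} = Set.univ :=
      Set.eq_univ_of_forall fun ω => Set.mem_iUnion.2 (exists_nat_ge ‖q 0 ω‖)
    rw [h2, measure_univ] at h1
    obtain ⟨j₀, hj₀⟩ := eventually_atTop.1 (h1.eventually_ne one_ne_zero)
    refine ⟨fun j => {ω | ‖q 0 ω‖ ≤ (j + j₀ : ℕ)}, fun j =>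
      measurableSet_le (hdyn.measurable_q 0).norm measurable_const,
      fun j => hj₀ _ (Nat.le_add_left _ _), ?_, fun j k =>
      hstepμ _ (hj₀ _ (Nat.le_add_left _ _)) k⟩
    have h3 := (ENNReal.tendsto_toReal ENNReal.one_ne_top).comp h1
    exact (tendsto_add_atTop_iff_nat j₀).2 h3
  have hPj : ∀ j, IsProbabilityMeasure μ[|A₀ j] := fun j => cond_isProbabilityMeasure (hA₀0 j)
  set p : Vec n → Vec n := coneProj c T with hp
  -- exponential moments: uniformly in `ε` for the distance to the cone, and for the norm
  set δ' := min (ε * δ₂) D with hδ'def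
  have hδ' : 0 < δ' := lt_min (mul_pos hε hδ₂) hD
  set θ' := δ' / (36 * D ^ 2) with hθ'def
  have hθ' : 0 < θ' := by positivity
  set A' := 2 * Real.exp (θ' * (16 * D ^ 2 / δ' + 3 * D)) / (θ' * δ' / 4) + 1 with hA'def
  have hcone : ∀ j, ∀ᶠ k in atTop,
      ∫ ω, Real.exp (θ * ‖q k ω - p (q k ω)‖) ∂μ[|A₀ j] ≤ A := fun j =>
    GeneralizedSwitch.eventually_integral_exp_le (fun k => (hA₀step j k).1) hδ hδD
      continuous_coneProj
      (fun x => nonneg_of_mem_normalCone hcb.c_nonneg (coneProj_mem x))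
      (fun x y => norm_sub_coneProj_le x (coneProj_mem y)) fun x hx =>
        (hdrift₁ ε hε hεδ x hx).trans
          (mul_le_mul_of_nonneg_right (neg_le_neg (min_le_left _ _)) (norm_nonneg _))
  have hnorm : ∀ j, ∀ᶠ k in atTop, ∫ ω, Real.exp (θ' * ‖q k ω‖) ∂μ[|A₀ j] ≤ A' := fun j => by
    have := GeneralizedSwitch.eventually_integral_exp_le (fun k => (hA₀step j k).1) hδ'
      (min_le_right _ _)
      (p := fun _ => 0) continuous_const (fun _ _ => le_rfl) (fun _ _ => le_rfl) fun x hx => by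
        have h1 := hdrift₂ ε hε hε_lt x hx
        have h2 := mul_le_mul_of_nonneg_right (min_le_left (ε * δ₂) D) (norm_nonneg x)
        rw [sub_zero, G.meanMaxWeight_zero]
        linarith
    simpa only [sub_zero] using this
  have hlate : ∀ j, ∃ k : ℕ, j ≤ k ∧
      ∫ ω, Real.exp (θ * ‖q k ω - p (q k ω)‖) ∂μ[|A₀ j] ≤ A ∧
      ∫ ω, Real.exp (θ * ‖q (k + 1) ω - p (q (k + 1) ω)‖) ∂μ[|A₀ j] ≤ A ∧
      ∫ ω, Real.exp (θ' * ‖q k ω‖) ∂μ[|A₀ j] ≤ A' ∧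
      ∫ ω, Real.exp (θ' * ‖q (k + 1) ω‖) ∂μ[|A₀ j] ≤ A' := fun j => by
    have hsucc := tendsto_add_atTop_nat 1
    exact ((eventually_ge_atTop j).and ((hcone j).and ((hsucc.eventually (hcone j)).and
      ((hnorm j).and (hsucc.eventually (hnorm j)))))).exists
  choose k hjk hk1 hk2 hk3 hk4 using hlate
  have hk : Tendsto k atTop atTop := tendsto_atTop_mono hjk tendsto_id
  have hlim : ∀ {f : Vec n → ℝ}, Continuous f → ∀ {K : ℝ}, 0 ≤ K →
      (∀ x, f x ^ 2 ≤ K * Real.exp (θ' * ‖x‖)) → Integrable (fun ω => f (qbar ω)) μ' ∧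
        Tendsto (fun j => ∫ ω, f (q (k j) ω) ∂μ[|A₀ j]) atTop (𝓝 (∫ ω, f (qbar ω) ∂μ')) ∧
        Tendsto (fun j => ∫ ω, f (q (k j + 1) ω) ∂μ[|A₀ j] - ∫ ω, f (q (k j) ω) ∂μ[|A₀ j])
          atTop (𝓝 0) := by
    intro f hf K hK hfK
    have h1 := tendsto_integral_cond hdyn.measurable_q hconv hA₀m hA₀0 hA₀1 hk
      (fun j => (hA₀step j (k j)).1.integrable_comp_q (f := fun x => Real.exp (θ' * ‖x‖))
        (by fun_prop)) hk3 hf hK hfK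
    have h2 := tendsto_integral_cond hdyn.measurable_q hconv hA₀m hA₀0 hA₀1
      ((tendsto_add_atTop_nat 1).comp hk)
      (fun j => (hA₀step j (k j)).1.integrable_comp_q' (f := fun x => Real.exp (θ' * ‖x‖))
        (by fun_prop)) hk4 hf hK hfK
    refine ⟨h1.1, h1.2, ?_⟩
    simpa using h2.2.sub h1.2
  have hlin : ∀ v : Vec n, ∀ x, inner ℝ v x ^ 2
      ≤ ‖v‖ ^ 2 * (Nat.factorial 2 / θ' ^ 2) * Real.exp (θ' * ‖x‖) := fun v x => by
    have h1 := sq_le_sq' (abs_le.1 (abs_real_inner_le_norm v x)).1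
      (abs_le.1 (abs_real_inner_le_norm v x)).2
    rw [mul_pow] at h1
    rw [mul_assoc]
    exact h1.trans (mul_le_mul_of_nonneg_left (pow_le_mul_exp hθ' (norm_nonneg x) 2) (sq_nonneg _))
  have hquad : ∃ K : ℝ, 0 ≤ K ∧ ∀ x, projForm c Pt x x ^ 2 ≤ K * Real.exp (θ' * ‖x‖) := by
    set Γ := ∑ ℓ : Pt, ∑ ℓ' : Pt, |((colMatrix c Pt)ᵀ * colMatrix c Pt)⁻¹ ℓ ℓ'|
    have hΓ : 0 ≤ Γ := Finset.sum_nonneg fun _ _ => Finset.sum_nonneg fun _ _ => abs_nonneg _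
    refine ⟨(Γ * Pt.card) ^ 2 * (Nat.factorial 4 / θ' ^ 4), by positivity, fun x => ?_⟩
    have h1 : |projForm c Pt x x| ≤ Γ * Pt.card * ‖x‖ ^ 2 := by
      refine (abs_projForm_le hcb.c_norm x x).trans ?_
      have : ∑ ℓ ∈ Pt, |inner ℝ (c ℓ) x| ≤ Pt.card * ‖x‖ := by
        rw [← nsmul_eq_mul]
        refine Finset.sum_le_card_nsmul _ _ _ fun ℓ _ => ?_
        simpa [hcb.c_norm] using abs_real_inner_le_norm (c ℓ) x
      calc _ ≤ Γ * (‖x‖ * (Pt.card * ‖x‖)) := by gcongr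
        _ = _ := by ring
    have h2 := sq_le_sq' (abs_le.1 h1).1 (abs_le.1 h1).2
    calc _ ≤ (Γ * Pt.card * ‖x‖ ^ 2) ^ 2 := h2
      _ = (Γ * Pt.card) ^ 2 * ‖x‖ ^ 4 := by ring
      _ ≤ (Γ * Pt.card) ^ 2 * (Nat.factorial 4 / θ' ^ 4 * Real.exp (θ' * ‖x‖)) := by
        gcongr
        exact pow_le_mul_exp hθ' (norm_nonneg x) 4
      _ = _ := by ring
  obtain ⟨K, hK, hKf⟩ := hquad
  have hlimw := hlim (f := fun x => inner ℝ x w) (by fun_prop)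
    (K := ‖w‖ ^ 2 * (Nat.factorial 2 / θ' ^ 2)) (by positivity)
    fun x => by rw [real_inner_comm]; exact hlin w x
  refine ⟨hlimw.1, ?_⟩
  -- the covariance of the arrivals is not affected by the conditioning
  have hcov : ∀ j, ∫ ω, projForm c Pt (a (k j) ω - (1 - ε) • ν) (a (k j) ω - (1 - ε) • ν) ∂μ[|A₀ j]
      = onesForm (projMatrix c Pt ⊙ covMatrix μ (a 1)) := fun j => by
    have hc : Continuous fun x : Vec n => projForm c Pt (x - (1 - ε) • ν) (x - (1 - ε) • ν) :=
      (continuous_projForm_self c Pt).comp (continuous_id.sub continuous_const)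
    rw [GeneralizedSwitch.onesForm_covMatrix (hdyn.measurable_a 1) ha1 hmean',
      ← integral_map (f := fun x => projForm c Pt (x - (1 - ε) • ν) (x - (1 - ε) • ν))
        (hdyn.measurable_a _).aemeasurable hc.aestronglyMeasurable, (hA₀step j (k j)).2,
      integral_map (hdyn.measurable_a 1).aemeasurable hc.aestronglyMeasurable]
  have hev1 : ∀ ℓ, ∀ᶠ j in atTop, |∫ ω, inner ℝ (c ℓ) (q (k j + 1) ω) ∂μ[|A₀ j]
      - ∫ ω, inner ℝ (c ℓ) (q (k j) ω) ∂μ[|A₀ j]| ≤ ε := fun ℓ => by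
    have h1 := (hlim (f := fun x => inner ℝ (c ℓ) x) (by fun_prop)
      (K := ‖c ℓ‖ ^ 2 * (Nat.factorial 2 / θ' ^ 2)) (by positivity) (hlin (c ℓ))).2.2.abs
    rw [abs_zero] at h1
    exact h1.eventually_le_const hε
  have hev2 : ∀ᶠ j in atTop, |∫ ω, projForm c Pt (q (k j + 1) ω) (q (k j + 1) ω) ∂μ[|A₀ j]
      - ∫ ω, projForm c Pt (q (k j) ω) (q (k j) ω) ∂μ[|A₀ j]| ≤ ε := by
    have h1 := (hlim (continuous_projForm_self c Pt) hK hKf).2.2.abs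
    rw [abs_zero] at h1
    exact h1.eventually_le_const hε
  have hfinal : ∀ᶠ j in atTop, |∫ ω, inner ℝ (q (k j) ω) w ∂μ[|A₀ j]
      - 1 / (2 * ε) * onesForm (projMatrix c Pt ⊙ covMatrix μ (a 1))
      - 1 / (2 * ε) * onesForm (((colMatrix c Pt)ᵀ * colMatrix c Pt)⁻¹ ⊙ G.covB c Pt)|
      ≤ β * Real.log (1 / ε) := by
    filter_upwards [eventually_all.2 hev1, hev2] with j h1 h2
    have h3 := hβ ε hε hε1.le Ω μ[|A₀ j] _ _ _ _ _ _ (hA₀step j (k j)).1 (hk1 j) (hk2 j) h1 h2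
      w hw hwF
    rwa [hcov j] at h3
  exact le_of_tendsto ((hlimw.2.1.sub_const _).sub_const _).abs hfinal
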